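/- **Setting.** Let $\pi$ be a probability density on a latent domain $\mathcal U\subset\mathbb R^d$, let $h^*:\mathcal U\to\mathbb R^D$ and let $\mathcal H$ be a class of maps $h:\mathcal U\to\mathbb R^D$, all measurable, with $\sup_{u\in\mathcal U}\|h^*(u)\|_2\le B$ and $\sup_{h\in\mathcal H}\sup_{u\in\mathcal U}\|h(u)\|_2\le B$, where $B>0$. Fix a noise level with $\alpha_t,\sigma_t>0$. Let $U\sim\pi$ and $Z\sim\mathcal N(0,I_D)$ be independent, $Y_0=h^*(U)$, $Y_t=\alpha_tY_0+\sigma_tZ$, and let $P$ be the joint law of $(Y_t,Y_0)$. Let $(y_t^i,y_0^i)$, $i=1,\dots,n$, be i.i.d. with law $P$. Write $\phi(y;m,\sigma^2I_D)$ for the density of $\mathcal N(m,\sigma^2 I_D)$ and $p(\cdot\mid y_0)=\phi(\cdot\,;\alpha_ty_0,\sigma_t^2I_D)$. For a map $h$ let $$p_t^h(y)=\int\phi(y;\alpha_th(u),\sigma_t^2I_D)\,\pi(u)\,du,\qquad s_t(y;h)=\nabla_y\log p_t^h(y),$$ $$\ell(y_t,y_0;h)=\bigl\|s_t(y_t;h)-\nabla_{y_t}\log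 p(y_t\mid y_0)\bigr\|_2^2,\qquad R(h)=\mathbb E\,\ell(Y_t,Y_0;h),$$ $$\rho^2(h^*,h)=R(h)-R(h^*),\qquad \rho(h^*,h)=\sqrt{\rho^2(h^*,h)}.$$ Given a proposal density $\tilde\pi(\cdot\mid y)$ and anchors $U^{(1)},\dots,U^{(K)}$ (any latent points, deterministic or random, which may depend on $y$ and on the sample; for instance i.i.d. draws from $\tilde\pi(\cdot\mid y)$), let $$\omega^{(j)}(y)=\frac{\pi(U^{(j)})}{\tilde\pi(U^{(j)}\mid y)}\,\phi\bigl(y;\alpha_th(U^{(j)}),\sigma_t^2I_D\bigr),\qquad \widetilde m_{t,K}(y)=\frac{\sum_j\omega^{(j)}(y)h(U^{(j)})}{\sum_j\omega^{(j)}(y)},$$ $$\widetilde s_{t,K}(y;h)=\sigma_t^{-2}\bigl(\alpha_t\widetilde m_{t,K}(y)-y\bigr),\qquad \ell_K(y_t,y_0;h)=\bigl\|\widetilde s_{t,K}(y_t;h)-\nabla_{y_t}\log p(y_t\mid y_0)\bigr\|_2^2.$$ Let $\hat h\in\arg\min_{h\in\mathcal H}\frac1n\sum_{i=1}^n\ell_K(y_t^i,y_0^i;h)$.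 Let $\mathcal F=\{\ell(\cdot,\cdot;h)-\ell(\cdot,\cdot;h^*):h\in\mathcal H\}$, and let $H_B(u,\mathcal F)$ be the logarithm of its $u$-bracketing number in $L_2(P)$. **Theorem.** Let $c_v=\frac{40\alpha_t^2B^2}{\sigma_t^4}$, $c_b=\frac{16\alpha_t^2B^2}{\sigma_t^4}$, let $k$ satisfy $0<\frac{c_b}{4c_v}\le k<1$, and put $c_h=k^{3/2}/2^{11}$. Then for every $\varepsilon>0$ satisfying $$\int_{k\varepsilon^2/16}^{4c_v^{1/2}\varepsilon}H_B^{1/2}(u,\mathcal F)\,du\le c_h\,n^{1/2}\varepsilon^2$$ and $$\varepsilon^2\ge\max\Bigl\{4\inf_{h\in\mathcal H}\rho^2(h^*,h),\ 8\sup_{h\in\mathcal H}\ \sup_{y_t\in\mathbb R^D,\ y_0\in h^*(\operatorname{supp}\pi)}\bigl|\ell_K(y_t,y_0;h)-\ell(y_t,y_0;h)\bigr|\Bigr\}$$ (almost surely, if the anchors are random), one has $$\mathbb P\bigl(\rho(h^*,\hat h)\ge\varepsilon\bigr)\le4\exp(-c_e\,n\,\varepsilon^2),\qquad c_e=\frac{1-k}{8\bigl(64c_v+\frac{2c_b}{3}\bigr)}.$$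 -/

import Mathlib

open MeasureTheory ProbabilityTheory
open scoped ENNReal

noncomputable section

namespace ScoreMatching

/-- `ℝᵐ` with its Euclidean norm. -/
abbrev E (m : ℕ) : Type := EuclideanSpace ℝ (Fin m)

/-- The density at `y` of the Gaussian law `N(m, σ² I)` on `ℝᴰ`. -/
def gaussianDensity {D : ℕ} (y m : E D) (σ : ℝ) : ℝ :=
  (2 * Real.pi * σ ^ 2) ^ (-(D : ℝ) / 2) * Real.exp (-‖y - m‖ ^ 2 / (2 * σ ^ 2))

/-- `π` is a probability density (with respect to Lebesgue measure) on the latent domain `𝒰`,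
extended by zero to the whole space. -/
structure IsLatentDensity {d : ℕ} (π : E d → ℝ) (𝒰 : Set (E d)) : Prop where
  measurable : Measurable π
  nonneg : ∀ u, 0 ≤ π u
  eq_zero : ∀ u, u ∉ 𝒰 → π u = 0
  lintegral_eq_one : ∫⁻ u, ENNReal.ofReal (π u) = 1

/-- The law of the latent variable `U`, with density `π`. -/
def latentLaw {d : ℕ} (π : E d → ℝ) : Measure (E d) :=
  volume.withDensity fun u => ENNReal.ofReal (π u)

/-- The density of `α h(U) + σ Z`, `U ∼ π`, `Z ∼ N(0, I)` independent: a Gaussian mixture. -/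
def smoothedDensity {d D : ℕ} (α σ : ℝ) (π : E d → ℝ) (h : E d → E D) (y : E D) : ℝ :=
  ∫ u, gaussianDensity y (α • h u) σ * π u

/-- The model score `s_t(y; h) = ∇ log p_t^h (y)`. -/
def score {d D : ℕ} (α σ : ℝ) (π : E d → ℝ) (h : E d → E D) (y : E D) : E D :=
  gradient (fun y' => Real.log (smoothedDensity α σ π h y')) y

/-- The conditional score `∇_y log p(y | y₀)`, with `p(· | y₀)` the density of `N(α y₀, σ² I)`. -/
def condScore {D : ℕ} (α σ : ℝ) (y y₀ : E D) : E D :=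
  gradient (fun y' => Real.log (gaussianDensity y' (α • y₀) σ)) y

/-- The ideal (infinite-anchor) loss, as a function of `x = (y_t, y_0)`. -/
def loss {d D : ℕ} (α σ : ℝ) (π : E d → ℝ) (h : E d → E D) (x : E D × E D) : ℝ :=
  ‖score α σ π h x.1 - condScore α σ x.1 x.2‖ ^ 2

/-- The unnormalized importance weight of a single anchor `u`, where `q` is the proposal density,
`q y` being the density `π̃(· | y)`. -/
def weight {d D : ℕ} (α σ : ℝ) (π : E d → ℝ) (q : E D → E d → ℝ) (h : E d → E D)
    (y : E D) (u : E d) : ℝ :=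
  π u / q y u * gaussianDensity y (α • h u) σ

/-- The self-normalized importance sampling estimate of the posterior mean, from the `K` anchors
`a y 0, …, a y (K - 1)` that are used at the observation `y`. -/
def anchorMean {d D K : ℕ} (α σ : ℝ) (π : E d → ℝ) (q : E D → E d → ℝ)
    (a : E D → Fin K → E d) (h : E d → E D) (y : E D) : E D :=
  (∑ j, weight α σ π q h y (a y j))⁻¹ • ∑ j, weight α σ π q h y (a y j) • h (a y j)

/-- The transport-based (finite-anchor) score estimator. -/
def anchorScore {d D K : ℕ} (α σ : ℝ) (π : E d → ℝ) (q : E D → E d → ℝ)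
    (a : E D → Fin K → E d) (h : E d → E D) (y : E D) : E D :=
  (1 / σ ^ 2) • (α • anchorMean α σ π q a h y - y)

/-- The finite-anchor loss `ℓ_K`, as a function of `x = (y_t, y_0)`. -/
def anchorLoss {d D K : ℕ} (α σ : ℝ) (π : E d → ℝ) (q : E D → E d → ℝ)
    (a : E D → Fin K → E d) (h : E d → E D) (x : E D × E D) : ℝ :=
  ‖anchorScore α σ π q a h x.1 - condScore α σ x.1 x.2‖ ^ 2

/-- The empirical finite-anchor risk `L_{n,K}` on the sample `x₁, …, xₙ`. -/
def empiricalRisk {d D K n : ℕ} (α σ : ℝ) (π : E d → ℝ) (q : E D → E d → ℝ)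
    (a : E D → Fin K → E d) (x : Fin n → E D × E D) (h : E d → E D) : ℝ :=
  (1 / (n : ℝ)) * ∑ i, anchorLoss α σ π q a h (x i)

/-- The joint law `P` of `(Y_t, Y_0)`, where `Y_0 = h*(U)`, `Y_t = α Y_0 + σ Z`, and `U ∼ π` and
`Z ∼ N(0, I)` are independent. -/
def dataLaw {d D : ℕ} (α σ : ℝ) (π : E d → ℝ) (hstar : E d → E D) : Measure (E D × E D) :=
  ((latentLaw π).prod (stdGaussian (E D))).map
    fun p => (α • hstar p.1 + σ • p.2, hstar p.1)

/-- The image manifold `ℳ* = h*(supp π)`; `h*` lives on `𝒰`. -/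
def targetManifold {d D : ℕ} (𝒰 : Set (E d)) (π : E d → ℝ) (hstar : E d → E D) : Set (E D) :=
  hstar '' (𝒰 ∩ tsupport π)

/-- The population risk `R(h)`. -/
def risk {d D : ℕ} (α σ : ℝ) (π : E d → ℝ) (hstar h : E d → E D) : ℝ :=
  ∫ x, loss α σ π h x ∂(dataLaw α σ π hstar)

/-- The excess risk `ρ²(h*, h)`. -/
def rhoSq {d D : ℕ} (α σ : ℝ) (π : E d → ℝ) (hstar h : E d → E D) : ℝ :=
  risk α σ π hstar h - risk α σ π hstar hstar

/-- `ρ(h*, h)`. -/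
def rho {d D : ℕ} (α σ : ℝ) (π : E d → ℝ) (hstar h : E d → E D) : ℝ :=
  √(rhoSq α σ π hstar h)

/-- `m` brackets `[lo j, up j]` of `L₂(P)`-size at most `δ` suffice to cover `F`. -/
def HasBracketCover {𝓧 : Type*} [MeasurableSpace 𝓧] (P : Measure 𝓧) (F : Set (𝓧 → ℝ))
    (δ : ℝ) (m : ℕ) : Prop :=
  ∃ lo up : Fin m → 𝓧 → ℝ,
    (∀ j, MemLp (lo j) 2 P ∧ MemLp (up j) 2 P ∧ eLpNorm (up j - lo j) 2 P ≤ ENNReal.ofReal δ) ∧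
    ∀ f ∈ F, ∃ j, ∀ x, lo j x ≤ f x ∧ f x ≤ up j x

/-- The bracketing number `N_B(δ, F, L₂(P))`; it is `⊤` if there is no finite cover. -/
def bracketingNumber {𝓧 : Type*} [MeasurableSpace 𝓧] (P : Measure 𝓧) (F : Set (𝓧 → ℝ))
    (δ : ℝ) : ℕ∞ :=
  sInf {N : ℕ∞ | ∃ m : ℕ, N = m ∧ HasBracketCover P F δ m}

/-- The bracketing entropy `H_B(δ, F) = log N_B(δ, F, L₂(P))`, with values in `[0, ∞]`. -/
def bracketingEntropy {𝓧 : Type*} [MeasurableSpace 𝓧] (P : Measure 𝓧) (F : Set (𝓧 → ℝ))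
    (δ : ℝ) : ℝ≥0∞ :=
  (ENNReal.log (bracketingNumber P F δ : ℝ≥0∞)).toENNReal

/-- The excess-loss class `{ℓ(·; h) - ℓ(·; h*) : h ∈ ℋ}`. -/
def excessLossClass {d D : ℕ} (α σ : ℝ) (π : E d → ℝ) (hstar : E d → E D)
    (ℋ : Set (E d → E D)) : Set (E D × E D → ℝ) :=
  (fun h => fun x => loss α σ π h x - loss α σ π hstar x) '' ℋ

/-- The constant `c_v = 40 α² B² / σ⁴`. -/
def cv (α σ B : ℝ) : ℝ := 40 * α ^ 2 * B ^ 2 / σ ^ 4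

/-- The constant `c_b = 16 α² B² / σ⁴`. -/
def cb (α σ B : ℝ) : ℝ := 16 * α ^ 2 * B ^ 2 / σ ^ 4

/-- The constant `c_h = k^{3/2} / 2¹¹`. -/
def ch (k : ℝ) : ℝ := k ^ (3 / 2 : ℝ) / 2 ^ 11

/-- The constant `c_e = (1 - k) / (8 (64 c_v + 2 c_b / 3))`. -/
def ce (α σ B k : ℝ) : ℝ := (1 - k) / (8 * (64 * cv α σ B + 2 * cb α σ B / 3))

end ScoreMatching

end

open ScoreMatching

noncomputable section

namespace ScoreMatching

/-! Write `A = αB/σ²`. By Tweedie's formula the model score at `y` is `(α m_h(y) - y)/σ²`, with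
`m_h` the posterior mean under `h`. The conditional score has the same form with `y₀` in place of
`m_h(y)`, so the loss is `(α/σ²)² ‖m_h(y_t) - y₀‖²`. Since `m_{h*}(Y_t)` is the conditional mean of
`Y₀`, Pythagoras gives `ρ² = (α/σ²)² E‖m_h - m_{h*}‖²` (`rhoSq_eq`). All posterior means are bounded
by `B`, so the excess loss is at most `4A²` in absolute value and has second moment at most `16A²ρ²`
(`integral_sq_excessLoss_le`): variance is controlled by risk.

If `ρ(h*, ĥ) ≥ ε`, comparing `ĥ` with a nearly optimal `h₀` shows that either the empirical excess
loss of `h₀` exceeds its mean by `ε²/32`, or on some shell `4^i ε² ≤ ρ² < 4^(i+1) ε²` an empirical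
excess loss falls below its mean by `(7/16) 4^i ε²` (`exists_deviation`). A Bernstein bound at the
single map `h₀` handles the first event.

The second event needs only a lower tail, uniformly over the shell. Lower brackets suffice: their
running maxima increase to `f`, so every link `L_j - L_{j+1}` is nonpositive. The Chernoff bound for
a variable bounded above by `0` has a purely quadratic exponent, hence no truncation is needed in
the chaining (`measure_exists_integral_sub_empMean_ge_le`). The entropy integral pays for the union
bounds, and the shell probabilities sum geometrically. -/

lemma exp_le_one_add_add_sq {x : ℝ} (hx : x ≤ 1) : Real.exp x ≤ 1 + x + x ^ 2 := by
  rcases le_or_gt (-1) x with h | h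
  · have := (abs_le.1 (Real.abs_exp_sub_one_sub_id_le (abs_le.2 ⟨h, hx⟩))).2
    linarith
  · have : Real.exp x ≤ 1 := Real.exp_le_one_iff.2 (by linarith)
    nlinarith

/-- The empirical mean of `f` over the sample `x`. -/
def empMean {𝓧 : Type*} {n : ℕ} (x : Fin n → 𝓧) (f : 𝓧 → ℝ) : ℝ :=
  (1 / (n : ℝ)) * ∑ i, f (x i)

lemma empMean_add {𝓧 : Type*} {n : ℕ} (x : Fin n → 𝓧) (f g : 𝓧 → ℝ) :
    empMean x (fun y => f y + g y) = empMean x f + empMean x g := by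
  simp only [empMean, Finset.sum_add_distrib, mul_add]

lemma empMean_sub {𝓧 : Type*} {n : ℕ} (x : Fin n → 𝓧) (f g : 𝓧 → ℝ) :
    empMean x (fun y => f y - g y) = empMean x f - empMean x g := by
  simp only [empMean, Finset.sum_sub_distrib, mul_sub]

lemma empMean_neg {𝓧 : Type*} {n : ℕ} (x : Fin n → 𝓧) (f : 𝓧 → ℝ) :
    empMean x (fun y => -f y) = -empMean x f := by
  simp only [empMean, Finset.sum_neg_distrib, mul_neg]

lemma empMean_mono {𝓧 : Type*} {n : ℕ} {x : Fin n → 𝓧} {f g : 𝓧 → ℝ}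
    (h : ∀ i, f (x i) ≤ g (x i)) : empMean x f ≤ empMean x g :=
  mul_le_mul_of_nonneg_left (Finset.sum_le_sum fun i _ => h i) (by positivity)

/-! ### One-sided Bernstein bound for empirical means. -/

section
variable {𝓧 Ω : Type*} [MeasurableSpace 𝓧] [MeasurableSpace Ω]

lemma ae_forall_sample {P : Measure 𝓧} {μ : Measure Ω} {n : ℕ} {X : Fin n → Ω → 𝓧}
    (hX : ∀ i, HasLaw (X i) P μ) {p : 𝓧 → Prop} (hp : ∀ᵐ x ∂P, p x) :
    ∀ᵐ ω ∂μ, ∀ i, p (X i ω) := by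
  rw [ae_all_iff]
  intro i
  have := hp
  rw [← (hX i).map_eq] at this
  exact ae_of_ae_map (hX i).aemeasurable this

/-- A Bernstein-type upper tail bound for the empirical mean of a function bounded above. -/
theorem measure_empMean_sub_integral_ge_le {P : Measure 𝓧} [IsProbabilityMeasure P]
    {μ : Measure Ω} [IsProbabilityMeasure μ] {n : ℕ} {X : Fin n → Ω → 𝓧}
    (hind : iIndepFun X μ) (hX : ∀ i, HasLaw (X i) P μ) {φ : 𝓧 → ℝ} (hφ : MemLp φ 2 P)
    {b V t : ℝ} (hV : 0 < V) (ht : 0 ≤ t) (hb : ∀ᵐ x ∂P, φ x ≤ b)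
    (hφV : ∫ x, φ x ^ 2 ∂P ≤ V) (htb : t * b ≤ 2 * V) :
    μ {ω | t ≤ empMean (fun i => X i ω) φ - ∫ x, φ x ∂P} ≤
      ENNReal.ofReal (Real.exp (-(n * t ^ 2 / (4 * V)))) := by
  rcases Nat.eq_zero_or_pos n with rfl | hn
  · simpa using prob_le_one
  -- This `l` minimizes `-l t + l² V`. The hypothesis `t b ≤ 2V` says exactly that `l b ≤ 1`, so
  -- that `exp x ≤ 1 + x + x²` applies to `x = l φ`; no lower bound on `φ` is required.
  set l : ℝ := t / (2 * V) with hl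
  have hl0 : 0 ≤ l := by positivity
  have hlb : l * b ≤ 1 := by
    rw [hl, div_mul_eq_mul_div, div_le_one (by positivity)]; exact htb
  have hint : Integrable φ P := hφ.integrable (by norm_num)
  have hsq : Integrable (fun x => φ x ^ 2) P := hφ.integrable_sq
  have hlin : Integrable (fun x => 1 + l * φ x) P := (integrable_const _).add (hint.const_mul _)
  have hle1 : ∀ᵐ x ∂P, l * φ x ≤ 1 := by
    filter_upwards [hb] with x hx
    exact (mul_le_mul_of_nonneg_left hx hl0).trans hlb
  have hφm : AEMeasurable φ P := hφ.1.aemeasurable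
  have hmgf : mgf φ P l ≤ Real.exp (l * ∫ x, φ x ∂P + l ^ 2 * V) := by
    have h1 : mgf φ P l ≤ ∫ x, (1 + l * φ x + l ^ 2 * φ x ^ 2) ∂P := by
      apply integral_mono_of_nonneg
      · exact Filter.Eventually.of_forall fun x => (Real.exp_pos _).le
      · exact hlin.add (hsq.const_mul _)
      · filter_upwards [hle1] with x hx
        have := exp_le_one_add_add_sq hx
        rw [mul_pow] at this
        exact this
    rw [integral_add hlin (hsq.const_mul _),
      integral_add (integrable_const _) (hint.const_mul _), integral_const_mul,
      integral_const_mul] at h1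
    simp only [integral_const, probReal_univ, smul_eq_mul, mul_one] at h1
    have h2 := Real.add_one_le_exp (l * ∫ x, φ x ∂P + l ^ 2 * V)
    have h3 : l ^ 2 * ∫ x, φ x ^ 2 ∂P ≤ l ^ 2 * V := by gcongr
    linarith
  have hcomp : ∀ i, AEMeasurable (fun ω => φ (X i ω)) μ := fun i => by
    have h : AEMeasurable φ (μ.map (X i)) := by rw [(hX i).map_eq]; exact hφm
    exact h.comp_aemeasurable (hX i).aemeasurable
  have hind' : iIndepFun (fun i ω => φ (X i ω)) μ :=
    hind.comp₀ (fun _ => φ) (fun i => (hX i).aemeasurable)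
      (fun i => by rw [(hX i).map_eq]; exact hφm)
  have hmgfi : ∀ i, mgf (fun ω => φ (X i ω)) μ l = mgf φ P l := fun i => by
    have h : AEStronglyMeasurable (fun x => Real.exp (l * φ x)) (μ.map (X i)) := by
      rw [(hX i).map_eq]
      exact (Real.measurable_exp.comp_aemeasurable (hφm.const_mul l)).aestronglyMeasurable
    rw [mgf, mgf, ← integral_map (hX i).aemeasurable h, (hX i).map_eq]
  have hsum : mgf (∑ i, fun ω => φ (X i ω)) μ l = (mgf φ P l) ^ n := by
    rw [hind'.mgf_sum₀ hcomp]
    simp [hmgfi]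
  have hexpint : Integrable (fun ω => Real.exp (l * (∑ i, fun ω => φ (X i ω)) ω)) μ := by
    refine Integrable.of_bound (C := Real.exp n) ?_ ?_
    · have : AEMeasurable (∑ i, fun ω => φ (X i ω)) μ := Finset.aemeasurable_sum _ fun i _ => hcomp i
      exact (Real.measurable_exp.comp_aemeasurable (this.const_mul l)).aestronglyMeasurable
    · filter_upwards [ae_forall_sample hX hle1] with ω hω
      rw [Real.norm_of_nonneg (Real.exp_pos _).le, Real.exp_le_exp, Finset.sum_apply,
        Finset.mul_sum]
      calc ∑ i, l * φ (X i ω) ≤ ∑ _i : Fin n, (1 : ℝ) := Finset.sum_le_sum fun i _ => hω i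
        _ = n := by simp
  have hn' : (0 : ℝ) < n := by exact_mod_cast hn
  have key := measure_ge_le_exp_mul_mgf (μ := μ) (n * (t + ∫ x, φ x ∂P)) hl0 hexpint
  have hset : {ω | t ≤ empMean (fun i => X i ω) φ - ∫ x, φ x ∂P} =
      {ω | n * (t + ∫ x, φ x ∂P) ≤ (∑ i, fun ω => φ (X i ω)) ω} := by
    ext ω
    simp only [Set.mem_ofPred_eq, empMean, Finset.sum_apply]
    rw [le_sub_iff_add_le, one_div, inv_mul_eq_div, le_div_iff₀ hn', mul_comm]
  rw [hset]
  refine (ENNReal.le_ofReal_iff_toReal_le (measure_ne_top _ _) (Real.exp_pos _).le).2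
    (key.trans ?_)
  rw [hsum]
  calc Real.exp (-l * (n * (t + ∫ x, φ x ∂P))) * mgf φ P l ^ n
      ≤ Real.exp (-l * (n * (t + ∫ x, φ x ∂P))) *
          (Real.exp (l * ∫ x, φ x ∂P + l ^ 2 * V)) ^ n := by
        gcongr
        exact mgf_nonneg
    _ = Real.exp (-(n * t ^ 2 / (4 * V))) := by
        rw [← Real.exp_nat_mul, ← Real.exp_add]
        congr 1
        rw [hl]
        field_simp
        ring

end

/-! ### Running maxima of lower brackets. -/

section
variable {𝓧 : Type*}

/-- The running maximum of lower brackets, started at the level `-b`. -/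
def chainLower (b : ℝ) (lo : ℕ → 𝓧 → ℝ) : ℕ → 𝓧 → ℝ
  | 0 => fun x => max (lo 0 x) (-b)
  | j + 1 => fun x => max (chainLower b lo j x) (lo (j + 1) x)

lemma le_chainLower (b : ℝ) (lo : ℕ → 𝓧 → ℝ) (j : ℕ) (x : 𝓧) : lo j x ≤ chainLower b lo j x := by
  cases j with
  | zero => exact le_max_left _ _
  | succ j => exact le_max_right _ _

lemma chainLower_le_succ (b : ℝ) (lo : ℕ → 𝓧 → ℝ) (j : ℕ) (x : 𝓧) :
    chainLower b lo j x ≤ chainLower b lo (j + 1) x := le_max_left _ _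

lemma chainLower_le {b : ℝ} {lo : ℕ → 𝓧 → ℝ} {J : ℕ} {x : 𝓧} {y : ℝ} (hb : -b ≤ y)
    (h : ∀ j ≤ J, lo j x ≤ y) : ∀ j ≤ J, chainLower b lo j x ≤ y
  | 0, hj => max_le (h 0 hj) hb
  | j + 1, hj => max_le (chainLower_le hb h j (by omega)) (h (j + 1) hj)

/-- Level `j` of the chain of `f` depends on `f` only through the brackets chosen at levels up to
`j`. This makes the union bounds finite although the class may be uncountable. -/
lemma chainLower_congr {b : ℝ} {lo lo' : ℕ → 𝓧 → ℝ} :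
    ∀ j, (∀ l ≤ j, lo l = lo' l) → chainLower b lo j = chainLower b lo' j
  | 0, h => by funext x; simp [chainLower, h 0 le_rfl]
  | j + 1, h => by
    funext x
    simp only [chainLower]
    rw [chainLower_congr j fun l hl => h l (by omega), h (j + 1) le_rfl]

end

/-! ### Chaining for the lower tail. -/

section
variable {𝓧 Ω : Type*} [MeasurableSpace 𝓧] [MeasurableSpace Ω]

/-- A union bound over a family of events that factors through a finite type. -/
lemma measure_iUnion_le_card_mul {μ : Measure Ω} {G κ : Type*} [Fintype κ] (r : G → κ)
    (A : G → Set Ω) (hA : ∀ g g', r g = r g' → A g = A g') {p : ℝ≥0∞} (hp : ∀ g, μ (A g) ≤ p) :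
    μ (⋃ g, A g) ≤ Fintype.card κ * p := by
  have h1 : (⋃ g, A g) ⊆ ⋃ c : κ, ⋃ g : {g // r g = c}, A g := by
    intro ω hω
    obtain ⟨g, hg⟩ := Set.mem_iUnion.1 hω
    exact Set.mem_iUnion.2 ⟨r g, Set.mem_iUnion.2 ⟨⟨g, rfl⟩, hg⟩⟩
  have h2 : ∀ c : κ, μ (⋃ g : {g // r g = c}, A g) ≤ p := by
    intro c
    rcases isEmpty_or_nonempty {g // r g = c} with he | ⟨⟨g₀, hg₀⟩⟩
    · simp
    · refine (measure_mono (Set.iUnion_subset fun g => ?_)).trans (hp g₀)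
      rw [hA g g₀ (g.2.trans hg₀.symm)]
  calc μ (⋃ g, A g) ≤ μ (⋃ c : κ, ⋃ g : {g // r g = c}, A g) := measure_mono h1
    _ ≤ ∑ c : κ, μ (⋃ g : {g // r g = c}, A g) := measure_iUnion_fintype_le _ _
    _ ≤ ∑ _c : κ, p := Finset.sum_le_sum fun c _ => h2 c
    _ = Fintype.card κ * p := by simp

lemma eLpNorm_two_le_ofReal_iff {P : Measure 𝓧} {g : 𝓧 → ℝ} (hg : MemLp g 2 P) {c : ℝ}
    (hc : 0 ≤ c) : eLpNorm g 2 P ≤ ENNReal.ofReal c ↔ ∫ x, g x ^ 2 ∂P ≤ c ^ 2 := by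
  rw [hg.eLpNorm_eq_integral_rpow_norm (by norm_num) (by norm_num),
    ENNReal.ofReal_le_ofReal_iff hc]
  simp only [ENNReal.toReal_ofNat, Real.rpow_ofNat, Real.norm_eq_abs, sq_abs]
  have h0 : 0 ≤ ∫ x, g x ^ 2 ∂P := integral_nonneg fun x => sq_nonneg _
  rw [← one_div, ← Real.sqrt_eq_rpow, Real.sqrt_le_left hc]

lemma memLp_chainLower {P : Measure 𝓧} [IsFiniteMeasure P] {b : ℝ} {lo : ℕ → 𝓧 → ℝ} {J : ℕ}
    (h : ∀ j ≤ J, MemLp (lo j) 2 P) : ∀ j ≤ J, MemLp (chainLower b lo j) 2 P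
  | 0, hj => (h 0 hj).sup (memLp_const (-b))
  | j + 1, hj => (memLp_chainLower h j (by omega)).sup (h (j + 1) hj)

/-- The lower-tail chaining bound along nested lower brackets. -/
theorem measure_exists_integral_sub_empMean_ge_le {P : Measure 𝓧} [IsProbabilityMeasure P]
    {μ : Measure Ω} [IsProbabilityMeasure μ] {n : ℕ} {X : Fin n → Ω → 𝓧}
    (hind : iIndepFun X μ) (hX : ∀ i, HasLaw (X i) P μ) {F : Set (𝓧 → ℝ)} {b v : ℝ}
    (hv : 0 ≤ v) (hFb : ∀ᵐ x ∂P, ∀ f ∈ F, -b ≤ f x) (hFm : ∀ f ∈ F, MemLp f 2 P)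
    (hFv : ∀ f ∈ F, ∫ x, f x ^ 2 ∂P ≤ v ^ 2) {J : ℕ} {δ : ℕ → ℝ} (hδ : ∀ j, 0 < δ j) {N : ℕ → ℕ}
    (hcov : ∀ j ≤ J, HasBracketCover P F (δ j) (N j)) {t₀ : ℝ} (ht₀ : 0 ≤ t₀)
    (ht₀b : t₀ * b ≤ 2 * (v + δ 0) ^ 2) {t : ℕ → ℝ} (ht : ∀ j, 0 ≤ t j) {T : ℝ}
    (hT : t₀ + ∑ j ∈ Finset.range J, t j + δ J ≤ T) :
    μ {ω | ∃ f ∈ F, T ≤ ∫ x, f x ∂P - empMean (fun i => X i ω) f} ≤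
      N 0 * ENNReal.ofReal (Real.exp (-(n * t₀ ^ 2 / (4 * (v + δ 0) ^ 2)))) +
        ∑ j ∈ Finset.range J, ((∏ l ∈ Finset.range (j + 2), N l : ℕ) : ℝ≥0∞) *
          ENNReal.ofReal (Real.exp (-(n * t j ^ 2 / (4 * δ j ^ 2)))) := by
  -- Brackets are indexed by `ℕ`, with junk value `0` outside the cover, so that the choices below
  -- do not depend on proofs of `j ≤ J`.
  have hex : ∀ j, ∃ lo up : ℕ → 𝓧 → ℝ, j ≤ J →
      (∀ c < N j, MemLp (lo c) 2 P ∧ MemLp (up c) 2 P ∧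
        eLpNorm (up c - lo c) 2 P ≤ ENNReal.ofReal (δ j)) ∧
      ∀ f ∈ F, ∃ c < N j, ∀ x, lo c x ≤ f x ∧ f x ≤ up c x := by
    intro j
    by_cases hj : j ≤ J
    · obtain ⟨lo, up, h1, h2⟩ := hcov j hj
      refine ⟨fun c => if h : c < N j then lo ⟨c, h⟩ else 0,
        fun c => if h : c < N j then up ⟨c, h⟩ else 0, fun _ => ⟨fun c hc => ?_, fun f hf => ?_⟩⟩
      · simpa [hc] using h1 ⟨c, hc⟩
      · obtain ⟨c, hc⟩ := h2 f hf
        exact ⟨c, c.2, by simpa using hc⟩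
    · exact ⟨0, 0, fun h => absurd h hj⟩
  choose lo up hlu using hex
  have hsel : ∀ (f : F) (j : ℕ), ∃ c, j ≤ J → c < N j ∧
      ∀ x, lo j c x ≤ (f : 𝓧 → ℝ) x ∧ (f : 𝓧 → ℝ) x ≤ up j c x := by
    intro f j
    by_cases hj : j ≤ J
    · obtain ⟨c, hc, h⟩ := (hlu j hj).2 f f.2
      exact ⟨c, fun _ => ⟨hc, h⟩⟩
    · exact ⟨0, fun h => absurd h hj⟩
  choose c hc using hsel
  set L : F → ℕ → 𝓧 → ℝ := fun f => chainLower b fun j => lo j (c f j) with hL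
  have hLm : ∀ f, ∀ j ≤ J, MemLp (L f j) 2 P := fun f =>
    memLp_chainLower fun j hj => ((hlu j hj).1 _ (hc f j hj).1).1
  have hLle : ∀ᵐ x ∂P, ∀ f : F, ∀ j ≤ J, L f j x ≤ (f : 𝓧 → ℝ) x := by
    filter_upwards [hFb] with x hx f
    exact chainLower_le (hx f f.2) fun j hj => ((hc f j hj).2 x).1
  -- Here `lo ≤ L f j ≤ f ≤ up`, so passing to the maximum only shrinks the gap.
  have hwidth : ∀ f : F, ∀ j ≤ J, eLpNorm (fun x => (f : 𝓧 → ℝ) x - L f j x) 2 P ≤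
      ENNReal.ofReal (δ j) := by
    intro f j hj
    refine (eLpNorm_mono_ae ?_).trans ((hlu j hj).1 _ (hc f j hj).1).2.2
    filter_upwards [hLle] with x hx
    have h1 := hx f j hj
    have h2 := (hc f j hj).2 x
    have h3 := le_chainLower b (fun j => lo j (c f j)) j x
    simp only [Pi.sub_apply, Real.norm_eq_abs]
    rw [abs_of_nonneg (by linarith), abs_of_nonneg (by linarith)]
    have : lo j (c f j) x ≤ L f j x := h3
    linarith
  -- Since `L f j ≤ L f (j + 1) ≤ f`, the link is dominated by `f - L f j`.
  have hlink : ∀ f : F, ∀ j < J, ∫ x, (L f j x - L f (j + 1) x) ^ 2 ∂P ≤ δ j ^ 2 := by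
    intro f j hj
    refine (eLpNorm_two_le_ofReal_iff ((hLm f j hj.le).sub (hLm f (j + 1) hj)) (hδ j).le).1
      ((eLpNorm_mono_ae ?_).trans (hwidth f j hj.le))
    filter_upwards [hLle] with x hx
    have h1 := hx f (j + 1) hj
    have h2 : L f j x ≤ L f (j + 1) x := chainLower_le_succ _ _ _ _
    simp only [Pi.sub_apply, Real.norm_eq_abs]
    rw [abs_of_nonpos (by linarith), abs_of_nonneg (by linarith)]
    linarith
  have hbase : ∀ f : F, ∫ x, (-L f 0 x) ^ 2 ∂P ≤ (v + δ 0) ^ 2 := by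
    intro f
    have hv0 : 0 ≤ v + δ 0 := add_nonneg hv (hδ 0).le
    refine (eLpNorm_two_le_ofReal_iff (hLm f 0 (Nat.zero_le _)).neg hv0).1 ?_
    have h1 : -L f 0 = (fun x => (f : 𝓧 → ℝ) x - L f 0 x) - (f : 𝓧 → ℝ) := by
      funext x; simp
    rw [h1, ENNReal.ofReal_add hv (hδ 0).le, add_comm]
    refine (eLpNorm_sub_le ((hFm f f.2).sub (hLm f 0 (Nat.zero_le _))).1 (hFm f f.2).1
      (by norm_num)).trans (add_le_add (hwidth f 0 (Nat.zero_le _)) ?_)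
    exact (eLpNorm_two_le_ofReal_iff (hFm f f.2) hv).2 (hFv f f.2)
  have hlast : ∀ f : F, ∫ x, (f : 𝓧 → ℝ) x ∂P - ∫ x, L f J x ∂P ≤ δ J := by
    intro f
    have hm : MemLp (fun x => (f : 𝓧 → ℝ) x - L f J x) 2 P := (hFm f f.2).sub (hLm f J le_rfl)
    rw [← integral_sub ((hFm f f.2).integrable (by norm_num))
      ((hLm f J le_rfl).integrable (by norm_num))]
    have h1 : eLpNorm (fun x => (f : 𝓧 → ℝ) x - L f J x) 1 P ≤ ENNReal.ofReal (δ J) :=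
      (eLpNorm_le_eLpNorm_of_exponent_le (by norm_num) hm.1).trans (hwidth f J le_rfl)
    rw [eLpNorm_one_eq_lintegral_enorm, ← ofReal_integral_norm_eq_lintegral_enorm
      (hm.integrable (by norm_num)), ENNReal.ofReal_le_ofReal_iff (hδ J).le] at h1
    exact (integral_mono (hm.integrable (by norm_num)) (hm.integrable (by norm_num)).norm
      fun x => le_abs_self _).trans h1
  set A₀ : F → Set Ω := fun f =>
    {ω | t₀ ≤ empMean (fun i => X i ω) (fun x => -L f 0 x) - ∫ x, -L f 0 x ∂P} with hA₀
  set A : ℕ → F → Set Ω := fun j f =>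
    {ω | t j ≤ empMean (fun i => X i ω) (fun x => L f j x - L f (j + 1) x) -
      ∫ x, (L f j x - L f (j + 1) x) ∂P} with hA
  have hA₀p : μ (⋃ f, A₀ f) ≤
      N 0 * ENNReal.ofReal (Real.exp (-(n * t₀ ^ 2 / (4 * (v + δ 0) ^ 2)))) := by
    have := measure_iUnion_le_card_mul (μ := μ)
      (fun f : F => (⟨c f 0, (hc f 0 (Nat.zero_le _)).1⟩ : Fin (N 0))) A₀ (fun f g h => ?_)
      (p := ENNReal.ofReal (Real.exp (-(n * t₀ ^ 2 / (4 * (v + δ 0) ^ 2))))) (fun f => ?_)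
    · simpa using this
    · have h0 : L f 0 = L g 0 := chainLower_congr 0 fun l hl => by
        obtain rfl : l = 0 := by omega
        rw [Fin.mk.inj_iff.1 h]
      simp only [hA₀, h0]
    · refine measure_empMean_sub_integral_ge_le hind hX (hLm f 0 (Nat.zero_le _)).neg
        (pow_pos (add_pos_of_nonneg_of_pos hv (hδ 0)) 2) ht₀ (b := b)
        (Filter.Eventually.of_forall fun x => ?_) (hbase f) ht₀b
      have : -b ≤ L f 0 x := le_max_right _ _
      simp only [Pi.neg_apply]
      linarith
  have hAp : ∀ j < J, μ (⋃ f, A j f) ≤ ((∏ l ∈ Finset.range (j + 2), N l : ℕ) : ℝ≥0∞) *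
      ENNReal.ofReal (Real.exp (-(n * t j ^ 2 / (4 * δ j ^ 2)))) := by
    intro j hj
    have := measure_iUnion_le_card_mul (μ := μ)
      (fun (f : F) (l : Fin (j + 2)) => (⟨c f l, (hc f l (by omega)).1⟩ : Fin (N l))) (A j)
      (fun f g h => ?_)
      (p := ENNReal.ofReal (Real.exp (-(n * t j ^ 2 / (4 * δ j ^ 2))))) (fun f => ?_)
    · rw [Fintype.card_pi] at this
      simp only [Fintype.card_fin] at this
      rwa [Fin.prod_univ_eq_prod_range (fun l => N l)] at this
    · have hcc : ∀ l ≤ j + 1, lo l (c f l) = lo l (c g l) := fun l hl => by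
        have := congrFun h ⟨l, by omega⟩
        rw [Fin.mk.inj_iff.1 this]
      have h0 : L f j = L g j := chainLower_congr j fun l hl => hcc l (by omega)
      have h1 : L f (j + 1) = L g (j + 1) := chainLower_congr (j + 1) fun l hl => hcc l hl
      simp only [hA, h0, h1]
    · refine measure_empMean_sub_integral_ge_le hind hX ((hLm f j hj.le).sub (hLm f (j + 1) hj))
        (pow_pos (hδ j) 2) (ht j) (b := 0)
        (Filter.Eventually.of_forall fun x => ?_) (hlink f j hj) (by have := hδ j; simp; positivity)
      have : L f j x ≤ L f (j + 1) x := chainLower_le_succ _ _ _ _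
      simp only [Pi.sub_apply]
      linarith
  -- Telescoping `P - P_n` along the chain: as `P_n L_J ≤ P_n f`, the deviation of `f` is at most
  -- that of `L_J` plus `P(f - L_J) ≤ δ J`. Off the bad events the total stays below `T`.
  have hsub : {ω | ∃ f ∈ F, T ≤ ∫ x, f x ∂P - empMean (fun i => X i ω) f} ≤ᵐ[μ]
      ((⋃ f, A₀ f) ∪ ⋃ j ∈ Finset.range J, ⋃ f, A j f : Set Ω) := by
    filter_upwards [ae_forall_sample hX hLle] with ω hω hmem
    obtain ⟨f, hf, hTf⟩ := hmem
    by_contra hcon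
    have hcon' : ω ∉ ((⋃ f, A₀ f) ∪ ⋃ j ∈ Finset.range J, ⋃ f, A j f : Set Ω) := hcon
    simp only [Set.mem_union, Set.mem_iUnion, not_or, not_exists, hA₀, hA, Set.mem_ofPred_eq,
      not_le, Finset.mem_range] at hcon'
    obtain ⟨h0, h1⟩ := hcon'
    have hstep : ∀ j ≤ J, ∫ x, L ⟨f, hf⟩ j x ∂P - empMean (fun i => X i ω) (L ⟨f, hf⟩ j) <
        t₀ + ∑ l ∈ Finset.range j, t l := by
      intro j
      induction j with
      | zero =>
        intro _
        have := h0 ⟨f, hf⟩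
        rw [empMean_neg, integral_neg] at this
        simp only [Finset.range_zero, Finset.sum_empty, add_zero]
        linarith
      | succ j ih =>
        intro hj
        have h2 := h1 j (by omega) ⟨f, hf⟩
        have h3 := ih (by omega)
        rw [empMean_sub, integral_sub ((hLm _ j (by omega)).integrable (by norm_num))
          ((hLm _ (j + 1) hj).integrable (by norm_num))] at h2
        rw [Finset.sum_range_succ]
        linarith
    have h4 := hstep J le_rfl
    have h5 : empMean (fun i => X i ω) (L ⟨f, hf⟩ J) ≤ empMean (fun i => X i ω) f :=
      empMean_mono fun i => hω i ⟨f, hf⟩ J le_rfl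
    have h6 := hlast ⟨f, hf⟩
    simp only at h6
    linarith
  refine (measure_mono_ae hsub).trans ((measure_union_le _ _).trans (add_le_add hA₀p ?_))
  refine (measure_biUnion_finset_le _ _).trans (Finset.sum_le_sum fun j hj => ?_)
  exact hAp j (Finset.mem_range.1 hj)

end

/-! ### Series estimates and the deviation bound on one shell. -/

lemma sum_range_half_pow_mul_le (J : ℕ) :
    ∑ j ∈ Finset.range J, (1 / 2 : ℝ) ^ j * (j + 2) ≤ 6 := by
  have : ∀ J : ℕ, ∑ j ∈ Finset.range J, (1 / 2 : ℝ) ^ j * (j + 2) =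
      6 - (1 / 2 : ℝ) ^ J * (2 * J + 6) := by
    intro J
    induction J with
    | zero => norm_num
    | succ J ih => rw [Finset.sum_range_succ, ih]; push_cast; ring
  rw [this]
  have : 0 ≤ (1 / 2 : ℝ) ^ J * (2 * J + 6) := by positivity
  linarith

/-- After exchanging the sums, `x l` is collected over `j ≥ l - 1`, with total weight at most `4 ·
2^(-l)`. The induction carries the geometric tail not yet spent at step `J`. -/
lemma sum_half_pow_mul_partialSum_le {x : ℕ → ℝ} (hx : ∀ j, 0 ≤ x j) (J : ℕ) :
    ∑ j ∈ Finset.range J, (1 / 2 : ℝ) ^ j * ∑ l ∈ Finset.range (j + 2), x l ≤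
      4 * ∑ l ∈ Finset.range (J + 1), (1 / 2 : ℝ) ^ l * x l := by
  have key : ∀ J : ℕ, ∑ j ∈ Finset.range J, (1 / 2 : ℝ) ^ j * ∑ l ∈ Finset.range (j + 2), x l +
      2 * (1 / 2 : ℝ) ^ J * ∑ l ∈ Finset.range (J + 1), x l ≤
      4 * ∑ l ∈ Finset.range (J + 1), (1 / 2 : ℝ) ^ l * x l := by
    intro J
    induction J with
    | zero => simp; linarith [hx 0]
    | succ J ih =>
      rw [Finset.sum_range_succ, Finset.sum_range_succ _ (J + 1), Finset.sum_range_succ _ (J + 1),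
        pow_succ]
      linarith
  have h0 : 0 ≤ 2 * (1 / 2 : ℝ) ^ J * ∑ l ∈ Finset.range (J + 1), x l :=
    mul_nonneg (by positivity) (Finset.sum_nonneg fun l _ => hx l)
  linarith [key J]

/-- Absorbs the cardinality of a union bound into the exponent. -/
lemma natCast_prod_mul_exp_le {N : ℕ → ℕ} {m : ℕ} (hN : ∀ l < m, 1 ≤ N l) {y z : ℝ}
    (h : ∑ l ∈ Finset.range m, Real.log (N l) + z ≤ y) :
    ((∏ l ∈ Finset.range m, N l : ℕ) : ℝ≥0∞) * ENNReal.ofReal (Real.exp (-y)) ≤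
      ENNReal.ofReal (Real.exp (-z)) := by
  rw [← ENNReal.ofReal_natCast, ← ENNReal.ofReal_mul (by positivity)]
  refine ENNReal.ofReal_le_ofReal ?_
  have h1 : ((∏ l ∈ Finset.range m, N l : ℕ) : ℝ) =
      Real.exp (∑ l ∈ Finset.range m, Real.log (N l)) := by
    rw [Real.exp_sum, Nat.cast_prod]
    refine Finset.prod_congr rfl fun l hl => (Real.exp_log ?_).symm
    exact_mod_cast hN l (Finset.mem_range.1 hl)
  rw [h1, ← Real.exp_add, Real.exp_le_exp]
  linarith

section
variable {𝓧 Ω : Type*} [MeasurableSpace 𝓧] [MeasurableSpace Ω]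

/-- The deviation bound on one shell `{ρ ≤ 2 s}` of the excess-loss class. -/
theorem measure_shell_le {P : Measure 𝓧} [IsProbabilityMeasure P]
    {μ : Measure Ω} [IsProbabilityMeasure μ] {n : ℕ} {X : Fin n → Ω → 𝓧}
    (hind : iIndepFun X μ) (hX : ∀ i, HasLaw (X i) P μ) {F : Set (𝓧 → ℝ)} {a s : ℝ}
    (ha : 0 < a) (hs : 0 < s) (hFb : ∀ᵐ x ∂P, ∀ f ∈ F, -(4 * a ^ 2) ≤ f x)
    (hFm : ∀ f ∈ F, MemLp f 2 P) (hFv : ∀ f ∈ F, ∫ x, f x ^ 2 ∂P ≤ (8 * a * s) ^ 2)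
    {J : ℕ} {δ : ℝ} (hδ₁ : a * s / 2 ≤ δ) (hδ₂ : δ ≤ a * s) (hδJ : δ * (1 / 2) ^ J ≤ s ^ 2 / 8)
    {N : ℕ → ℕ} (hN : ∀ j ≤ J, 1 ≤ N j)
    (hcov : ∀ j ≤ J, HasBracketCover P F (δ * (1 / 2) ^ j) (N j))
    (hent : ∑ j ∈ Finset.range (J + 1), δ * (1 / 2) ^ j * √(Real.log (N j)) ≤
      √n * s ^ 2 / 1024)
    {e : ℝ} (he : 0 ≤ e) (he' : e ≤ n * s ^ 2 / (20480 * a ^ 2)) :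
    μ {ω | ∃ f ∈ F, 7 / 16 * s ^ 2 ≤ ∫ x, f x ∂P - empMean (fun i => X i ω) f} ≤
      ENNReal.ofReal (Real.exp (-e)) +
        ∑ j ∈ Finset.range J, ENNReal.ofReal (Real.exp (-((j + 2) * e))) := by
  rcases Nat.eq_zero_or_pos n with rfl | hn
  · have : e = 0 := le_antisymm (by simpa using he') he
    subst this
    refine prob_le_one.trans ?_
    simp
  have hn' : (0 : ℝ) < n := by exact_mod_cast hn
  have hsn : 0 < √(n : ℝ) := Real.sqrt_pos.2 hn'
  have hsn2 : √(n : ℝ) ^ 2 = n := Real.sq_sqrt hn'.le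
  have hδ : 0 < δ := lt_of_lt_of_le (by positivity) hδ₁
  set x : ℕ → ℝ := fun j => √(Real.log (N j)) with hx
  have hx0 : ∀ j, 0 ≤ x j := fun j => Real.sqrt_nonneg _
  have hxsq : ∀ j ≤ J, x j ^ 2 = Real.log (N j) := fun j hj =>
    Real.sq_sqrt (Real.log_nonneg (by exact_mod_cast hN j hj))
  -- Chosen so that `n t_j² / (4 δ_j²)` is the square of the bracketed sum. That square dominates
  -- both the log-cardinality `∑ log N_l` of the union bound and the reserve `(j + 2) e`.
  set t : ℕ → ℝ := fun j =>
    2 * (δ * (1 / 2) ^ j) / √n * (∑ l ∈ Finset.range (j + 2), x l + (j + 2) * √e) with ht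
  have hS0 : ∀ m : ℕ, 0 ≤ ∑ l ∈ Finset.range m, x l := fun m => Finset.sum_nonneg fun l _ => hx0 l
  have ht0 : ∀ j, 0 ≤ t j := fun j => by
    have := hS0 (j + 2)
    simp only [ht]
    positivity
  -- `143² = 20449 ≤ 20480`.
  have hse : √e ≤ √n * s / (143 * a) := by
    rw [Real.sqrt_le_left (by positivity)]
    refine he'.trans ?_
    rw [div_pow, mul_pow, hsn2, mul_pow]
    gcongr
    norm_num
  have htsum : ∑ j ∈ Finset.range J, t j ≤ s ^ 2 / 8 := by
    have h1 : ∑ j ∈ Finset.range J, t j = 2 * δ / √n *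
        (∑ j ∈ Finset.range J, (1 / 2 : ℝ) ^ j * ∑ l ∈ Finset.range (j + 2), x l +
          √e * ∑ j ∈ Finset.range J, (1 / 2 : ℝ) ^ j * (j + 2)) := by
      simp only [ht, Finset.mul_sum, ← Finset.sum_add_distrib]
      refine Finset.sum_congr rfl fun j _ => ?_
      rw [← Finset.mul_sum]
      ring
    have h2 := sum_half_pow_mul_partialSum_le hx0 J
    have h3 := sum_range_half_pow_mul_le J
    have h4 : δ * ∑ l ∈ Finset.range (J + 1), (1 / 2 : ℝ) ^ l * x l ≤ √n * s ^ 2 / 1024 := by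
      refine le_of_eq_of_le ?_ hent
      rw [Finset.mul_sum]
      exact Finset.sum_congr rfl fun j _ => by ring
    rw [h1]
    have h5 : √e * ∑ j ∈ Finset.range J, (1 / 2 : ℝ) ^ j * (j + 2) ≤ √e * 6 := by gcongr
    have h6 : δ * √e ≤ √n * s ^ 2 / 143 := by
      calc δ * √e ≤ (a * s) * (√n * s / (143 * a)) := by gcongr
        _ = √n * s ^ 2 / 143 := by field_simp
    calc _ ≤ 2 * δ / √n * (4 * ∑ l ∈ Finset.range (J + 1), (1 / 2 : ℝ) ^ l * x l + √e * 6) := by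
          gcongr
      _ = (8 * (δ * ∑ l ∈ Finset.range (J + 1), (1 / 2 : ℝ) ^ l * x l) + 12 * (δ * √e)) / √n := by
          ring
      _ ≤ (8 * (√n * s ^ 2 / 1024) + 12 * (√n * s ^ 2 / 143)) / √n := by gcongr
      _ = (8 / 1024 + 12 / 143) * s ^ 2 := by field_simp
      _ ≤ s ^ 2 / 8 := by nlinarith [sq_nonneg s]
  have hδj : ∀ j : ℕ, 0 < δ * (1 / 2) ^ j := fun j => by positivity
  have hvδ : (8 * a * s + δ) ^ 2 ≤ 81 * (a * s) ^ 2 := by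
    have has : 0 < a * s := by positivity
    nlinarith
  have hvδ' : (8 * a * s) ^ 2 ≤ (8 * a * s + δ) ^ 2 := by
    have has : 0 < a * s := by positivity
    nlinarith
  -- The budget `7/16` is split as `3/16` for the base level, `1/8` for the links and `1/8` for the
  -- final width.
  refine (measure_exists_integral_sub_empMean_ge_le hind hX (by positivity : 0 ≤ 8 * a * s) hFb hFm
    hFv (J := J) hδj hcov (t₀ := 3 / 16 * s ^ 2) (by positivity) ?_ ht0
    (by linarith)).trans (add_le_add ?_ (Finset.sum_le_sum fun j hj => ?_))
  · simp only [pow_zero, mul_one]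
    nlinarith [sq_nonneg (a * s)]
  · have := natCast_prod_mul_exp_le (N := N) (m := 1) (fun l hl => hN l (by omega))
      (y := n * (3 / 16 * s ^ 2) ^ 2 / (4 * (8 * a * s + δ * (1 / 2) ^ 0) ^ 2)) (z := e) ?_
    · simpa using this
    · simp only [Finset.range_one, Finset.sum_singleton, pow_zero, mul_one]
      rw [← hxsq 0 (Nat.zero_le _)]
      have h1 : δ * x 0 ≤ √n * s ^ 2 / 1024 := by
        refine le_trans ?_ hent
        have := Finset.single_le_sum (f := fun j => δ * (1 / 2) ^ j * x j)
          (fun j _ => mul_nonneg (hδj j).le (hx0 j)) (Finset.mem_range.2 (Nat.succ_pos J))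
        simpa using this
      have h2 : x 0 ≤ √n * s / (512 * a) := by
        rw [le_div_iff₀ (by positivity)]
        have h3 : a * s / 2 * x 0 ≤ √n * s ^ 2 / 1024 :=
          (mul_le_mul_of_nonneg_right hδ₁ (hx0 0)).trans h1
        have h4 : s * (x 0 * (512 * a)) ≤ s * (√n * s) := by nlinarith
        exact le_of_mul_le_mul_left h4 hs
      have h3 : x 0 ^ 2 ≤ n * s ^ 2 / (262144 * a ^ 2) := by
        calc x 0 ^ 2 ≤ (√n * s / (512 * a)) ^ 2 := pow_le_pow_left₀ (hx0 0) h2 2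
          _ = n * s ^ 2 / (262144 * a ^ 2) := by rw [div_pow, mul_pow, hsn2]; ring
      -- With `v + δ ≤ 9as`, the base exponent is at least `(3/16)² n s² / (4 · 81 a²) = n s² /
      -- (9216 a²)`, which covers `log N_0` and `e` together.
      calc x 0 ^ 2 + e ≤ n * s ^ 2 / (262144 * a ^ 2) + n * s ^ 2 / (20480 * a ^ 2) :=
            add_le_add h3 he'
        _ = (1 / 262144 + 1 / 20480) * (n * s ^ 2 / a ^ 2) := by ring
        _ ≤ (1 / 9216) * (n * s ^ 2 / a ^ 2) := by gcongr; norm_num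
        _ = n * (3 / 16 * s ^ 2) ^ 2 / (4 * (81 * (a * s) ^ 2)) := by field_simp; norm_num
        _ ≤ _ := by gcongr
  · have hj' := Finset.mem_range.1 hj
    refine natCast_prod_mul_exp_le (fun l hl => hN l (by omega)) ?_
    have h1 : n * t j ^ 2 / (4 * (δ * (1 / 2) ^ j) ^ 2) =
        (∑ l ∈ Finset.range (j + 2), x l + (j + 2) * √e) ^ 2 := by
      simp only [ht]
      have := hδj j
      rw [mul_pow, div_pow, hsn2]
      generalize ∑ l ∈ Finset.range (j + 2), x l + (j + 2) * √e = q
      field_simp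
      ring
    rw [h1]
    have h2 : ∑ l ∈ Finset.range (j + 2), Real.log (N l) ≤
        (∑ l ∈ Finset.range (j + 2), x l) ^ 2 := by
      rw [← Finset.sum_congr rfl fun l hl => hxsq l (by
        have := Finset.mem_range.1 hl; omega)]
      exact Finset.sum_sq_le_sq_sum_of_nonneg fun l _ => hx0 l
    have h3 := hS0 (j + 2)
    have h4 : √e ^ 2 = e := Real.sq_sqrt he
    have h5 : (j + 2) * e ≤ ((j + 2) * √e) ^ 2 := by
      rw [mul_pow, h4]
      have : (0 : ℝ) ≤ j := Nat.cast_nonneg j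
      gcongr
      nlinarith
    have h6 : 0 ≤ (j + 2) * √e := by positivity
    nlinarith

end

/-! ### Gaussian densities -/

section Gaussian
variable {D : ℕ}

lemma gaussianDensity_pos {σ : ℝ} (hσ : 0 < σ) (y m : E D) : 0 < gaussianDensity y m σ := by
  have := Real.pi_pos
  unfold gaussianDensity
  positivity

lemma gaussianDensity_le {σ : ℝ} (y m : E D) :
    gaussianDensity y m σ ≤ (2 * Real.pi * σ ^ 2) ^ (-(D : ℝ) / 2) := by
  have := Real.pi_pos
  unfold gaussianDensity
  refine mul_le_of_le_one_right (by positivity) (Real.exp_le_one_iff.2 ?_)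
  rw [neg_div]
  exact neg_nonpos.2 (by positivity)

lemma continuous_gaussianDensity (σ : ℝ) :
    Continuous fun p : E D × E D => gaussianDensity p.1 p.2 σ := by
  unfold gaussianDensity
  fun_prop

lemma integral_gaussianDensity {σ : ℝ} (hσ : 0 < σ) (m : E D) :
    ∫ y, gaussianDensity y m σ = 1 := by
  have hp := Real.pi_pos
  have h1 : ∫ y, gaussianDensity y m σ = ∫ y, gaussianDensity (y + m) m σ :=
    (integral_add_right_eq_self (fun y => gaussianDensity y m σ) m).symm
  have h2 := GaussianFourier.integral_rexp_neg_mul_sq_norm (V := E D)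
    (b := 1 / (2 * σ ^ 2)) (by positivity)
  rw [h1]
  simp only [gaussianDensity, add_sub_cancel_right]
  rw [integral_const_mul]
  have h3 : ∀ y : E D, -‖y‖ ^ 2 / (2 * σ ^ 2) = -(1 / (2 * σ ^ 2)) * ‖y‖ ^ 2 := fun y => by ring
  simp only [h3, h2, finrank_euclideanSpace, Fintype.card_fin]
  rw [show Real.pi / (1 / (2 * σ ^ 2)) = 2 * Real.pi * σ ^ 2 by field_simp,
    ← Real.rpow_add (by positivity), show -(D : ℝ) / 2 + D / 2 = 0 by ring, Real.rpow_zero]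

lemma integrable_gaussianDensity {σ : ℝ} (hσ : 0 < σ) (m : E D) :
    Integrable fun y => gaussianDensity y m σ :=
  integrable_of_integral_eq_one (integral_gaussianDensity hσ m)

/-- The law of `c + σ Z` with `Z` standard Gaussian has density `gaussianDensity · c σ`. -/
theorem map_stdGaussian_affine {σ : ℝ} (hσ : 0 < σ) (c : E D) :
    (stdGaussian (E D)).map (fun z => c + σ • z) =
      volume.withDensity fun y => ENNReal.ofReal (gaussianDensity y c σ) := by
  have hp := Real.pi_pos
  have hmeas : Measurable fun y : E D => ENNReal.ofReal (gaussianDensity y c σ) := by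
    have := (continuous_gaussianDensity (D := D) σ).comp (Continuous.prodMk_left c)
    exact this.measurable.ennreal_ofReal
  have hm : Measurable fun z : E D => c + σ • z := by fun_prop
  have : IsProbabilityMeasure ((stdGaussian (E D)).map fun z => c + σ • z) :=
    Measure.isProbabilityMeasure_map hm.aemeasurable
  have : IsFiniteMeasure (volume.withDensity fun y : E D =>
      ENNReal.ofReal (gaussianDensity y c σ)) :=
    isFiniteMeasure_withDensity_ofReal (integrable_gaussianDensity hσ c).2
  refine Measure.ext_of_charFun ?_
  funext t
  have hL : charFun ((stdGaussian (E D)).map fun z => c + σ • z) t =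
      Complex.exp (inner ℝ c t * Complex.I) * Complex.exp (-(σ ^ 2 * ‖t‖ ^ 2) / 2) := by
    rw [charFun_apply, integral_map hm.aemeasurable (by fun_prop)]
    have h1 := charFun_stdGaussian (E := E D) (σ • t)
    rw [charFun_apply] at h1
    have h2 : ∀ z : E D, Complex.exp ((inner ℝ (c + σ • z) t : ℝ) * Complex.I) =
        Complex.exp (inner ℝ c t * Complex.I) *
          Complex.exp ((inner ℝ z (σ • t) : ℝ) * Complex.I) := by
      intro z
      rw [← Complex.exp_add, inner_add_left, real_inner_smul_left, real_inner_smul_right]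
      push_cast
      ring_nf
    simp only [h2]
    rw [integral_const_mul, h1, norm_smul]
    congr 2
    simp only [Real.norm_eq_abs, abs_of_pos hσ]
    push_cast
    ring
  have hR : charFun (volume.withDensity fun y => ENNReal.ofReal (gaussianDensity y c σ)) t =
      Complex.exp (inner ℝ c t * Complex.I) * Complex.exp (-(σ ^ 2 * ‖t‖ ^ 2) / 2) := by
    rw [charFun_apply, integral_withDensity_eq_integral_toReal_smul hmeas
      (Filter.Eventually.of_forall fun _ => ENNReal.ofReal_lt_top)]
    simp only [ENNReal.toReal_ofReal (gaussianDensity_pos hσ _ _).le]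
    rw [← integral_add_right_eq_self _ c]
    have h2 : ∀ y : E D, gaussianDensity (y + c) c σ •
        Complex.exp ((inner ℝ (y + c) t : ℝ) * Complex.I) =
        (((2 * Real.pi * σ ^ 2) ^ (-(D : ℝ) / 2) : ℝ) *
          Complex.exp (inner ℝ c t * Complex.I)) *
          Complex.exp (-((1 / (2 * σ ^ 2) : ℝ) : ℂ) * ‖y‖ ^ 2 +
            Complex.I * (inner ℝ t y : ℝ)) := by
      intro y
      simp only [gaussianDensity, add_sub_cancel_right, Complex.real_smul]
      rw [inner_add_left, real_inner_comm y t]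
      generalize (2 * Real.pi * σ ^ 2) ^ (-(D : ℝ) / 2) = C
      push_cast
      rw [mul_assoc, mul_assoc, ← Complex.exp_add, ← Complex.exp_add]
      congr 2
      ring
    simp only [h2]
    rw [integral_const_mul]
    have h3 := GaussianFourier.integral_cexp_neg_mul_sq_norm_add (V := E D)
      (b := ((1 / (2 * σ ^ 2) : ℝ) : ℂ)) (by rw [Complex.ofReal_re]; positivity) Complex.I t
    rw [h3]
    have h4 : ((Real.pi : ℂ) / ((1 / (2 * σ ^ 2) : ℝ) : ℂ)) ^
        ((Module.finrank ℝ (E D) : ℂ) / 2) =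
        (((2 * Real.pi * σ ^ 2) ^ ((D : ℝ) / 2) : ℝ) : ℂ) := by
      rw [finrank_euclideanSpace, Fintype.card_fin, Complex.ofReal_cpow (by positivity)]
      congr 1
      · push_cast
        have : (σ : ℂ) ≠ 0 := by exact_mod_cast hσ.ne'
        field_simp
      · push_cast; ring
    rw [h4]
    have h5 : (((2 * Real.pi * σ ^ 2) ^ (-(D : ℝ) / 2) : ℝ) : ℂ) *
        (((2 * Real.pi * σ ^ 2) ^ ((D : ℝ) / 2) : ℝ) : ℂ) = 1 := by
      rw [← Complex.ofReal_mul, ← Real.rpow_add (by positivity),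
        show -(D : ℝ) / 2 + D / 2 = 0 by ring, Real.rpow_zero, Complex.ofReal_one]
    have h6 : Complex.I ^ 2 * (‖t‖ : ℂ) ^ 2 / (4 * ((1 / (2 * σ ^ 2) : ℝ) : ℂ)) =
        -(σ ^ 2 * ‖t‖ ^ 2) / 2 := by
      have : (σ : ℂ) ≠ 0 := by exact_mod_cast hσ.ne'
      push_cast
      rw [Complex.I_sq]
      field_simp
      norm_num
    rw [h6]
    linear_combination (Complex.exp (inner ℝ c t * Complex.I) *
      Complex.exp (-(σ ^ 2 * ‖t‖ ^ 2) / 2)) * h5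
  rw [hL, hR]

lemma integral_stdGaussian_affine {σ : ℝ} (hσ : 0 < σ) (c : E D) {f : E D → ℝ}
    (hf : Measurable f) :
    ∫ z, f (c + σ • z) ∂(stdGaussian (E D)) = ∫ y, gaussianDensity y c σ * f y := by
  have hmeas : Measurable fun y : E D => ENNReal.ofReal (gaussianDensity y c σ) :=
    ((continuous_gaussianDensity (D := D) σ).comp
      (Continuous.prodMk_left c)).measurable.ennreal_ofReal
  rw [← integral_map (φ := fun z : E D => c + σ • z) (by fun_prop) hf.aestronglyMeasurable,
    map_stdGaussian_affine hσ,
    integral_withDensity_eq_integral_toReal_smul hmeas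
      (Filter.Eventually.of_forall fun _ => ENNReal.ofReal_lt_top)]
  simp only [ENNReal.toReal_ofReal (gaussianDensity_pos hσ _ _).le, smul_eq_mul]

lemma hasFDerivAt_gaussianDensity {σ : ℝ} (m y : E D) :
    HasFDerivAt (fun y => gaussianDensity y m σ)
      ((gaussianDensity y m σ * (1 / σ ^ 2)) • innerSL ℝ (m - y)) y := by
  have h1 : HasFDerivAt (fun y : E D => y - m) (ContinuousLinearMap.id ℝ (E D)) y :=
    (hasFDerivAt_id y).sub_const m
  have h2 := ((h1.norm_sq.const_mul (-1 / (2 * σ ^ 2))).exp).const_mul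
    ((2 * Real.pi * σ ^ 2) ^ (-(D : ℝ) / 2))
  have h3 : (fun y => gaussianDensity y m σ) = fun y =>
      (2 * Real.pi * σ ^ 2) ^ (-(D : ℝ) / 2) *
        Real.exp (-1 / (2 * σ ^ 2) * ‖y - m‖ ^ 2) := by
    funext y
    unfold gaussianDensity
    congr 2
    ring
  have h4 := congrFun h3 y
  rw [h4, h3]
  refine h2.congr_fderiv ?_
  ext v
  simp only [smul_apply, ContinuousLinearMap.comp_apply,
    ContinuousLinearMap.id_apply, innerSL_apply_apply, smul_eq_mul, nsmul_eq_mul, inner_sub_left]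
  push_cast
  ring

lemma condScore_eq {α σ : ℝ} (hσ : 0 < σ) (y y₀ : E D) :
    condScore α σ y y₀ = (1 / σ ^ 2) • (α • y₀ - y) := by
  refine HasGradientAt.gradient ?_
  rw [hasGradientAt_iff_hasFDerivAt]
  have hg := gaussianDensity_pos hσ y (α • y₀)
  refine ((hasFDerivAt_gaussianDensity (σ := σ) (α • y₀) y).log hg.ne').congr_fderiv ?_
  ext v
  simp only [smul_apply, innerSL_apply_apply, smul_eq_mul,
    InnerProductSpace.toDual_apply_apply, real_inner_smul_left]
  field_simp

end Gaussian

/-! ### The latent law -/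

section Latent
variable {d : ℕ} {π : E d → ℝ} {𝒰 : Set (E d)}

lemma IsLatentDensity.isProbabilityMeasure (hπ : IsLatentDensity π 𝒰) :
    IsProbabilityMeasure (latentLaw π) := by
  refine ⟨?_⟩
  rw [latentLaw, withDensity_apply _ MeasurableSet.univ, Measure.restrict_univ,
    hπ.lintegral_eq_one]

lemma IsLatentDensity.ae_mem (hπ : IsLatentDensity π 𝒰) :
    ∀ᵐ u ∂(latentLaw π), u ∈ 𝒰 ∩ tsupport π := by
  rw [latentLaw, ae_withDensity_iff hπ.measurable.ennreal_ofReal]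
  refine Filter.Eventually.of_forall fun u hu => ?_
  have h0 : π u ≠ 0 := fun h => hu (by simp [h])
  exact ⟨by_contra fun h => h0 (hπ.eq_zero u h), subset_tsupport π h0⟩

lemma IsLatentDensity.integral_mul_eq (hπ : IsLatentDensity π 𝒰) (f : E d → ℝ) :
    ∫ u, f u * π u = ∫ u, f u ∂(latentLaw π) := by
  rw [latentLaw, integral_withDensity_eq_integral_toReal_smul hπ.measurable.ennreal_ofReal
    (Filter.Eventually.of_forall fun _ => ENNReal.ofReal_lt_top)]
  refine integral_congr_ae (Filter.Eventually.of_forall fun u => ?_)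
  simp only [ENNReal.toReal_ofReal (hπ.nonneg u), smul_eq_mul]
  ring

end Latent

/-! ### Posterior means and scores -/

section Score
variable {𝓤 : Type*} [MeasurableSpace 𝓤] {D : ℕ}

/-- The density of `α h(U) + σ Z` for `U ∼ ν`. -/
def mixDensity (ν : Measure 𝓤) (α σ : ℝ) (h : 𝓤 → E D) (y : E D) : ℝ :=
  ∫ u, gaussianDensity y (α • h u) σ ∂ν

/-- The posterior mean of `h(U)` given `α h(U) + σ Z = y`, for `U ∼ ν`. -/
def postMean (ν : Measure 𝓤) (α σ : ℝ) (h : 𝓤 → E D) (y : E D) : E D :=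
  (mixDensity ν α σ h y)⁻¹ • ∫ u, gaussianDensity y (α • h u) σ • h u ∂ν

variable {ν : Measure 𝓤} [IsProbabilityMeasure ν] {α σ B : ℝ} {h : 𝓤 → E D}

lemma measurable_gaussianDensity_comp (σ α : ℝ) (hm : Measurable h) :
    Measurable fun p : E D × 𝓤 => gaussianDensity p.1 (α • h p.2) σ := by
  unfold gaussianDensity
  fun_prop

lemma integrable_gaussianDensity_comp (hσ : 0 < σ) (hm : Measurable h) (y : E D) :
    Integrable (fun u => gaussianDensity y (α • h u) σ) ν := by
  refine Integrable.of_bound (C := (2 * Real.pi * σ ^ 2) ^ (-(D : ℝ) / 2))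
    ((measurable_gaussianDensity_comp σ α hm).comp
      measurable_prodMk_left).aestronglyMeasurable (Filter.Eventually.of_forall fun u => ?_)
  rw [Real.norm_of_nonneg (gaussianDensity_pos hσ _ _).le]
  exact gaussianDensity_le _ _

lemma integrable_gaussianDensity_smul (hσ : 0 < σ) (hm : Measurable h)
    (hb : ∀ᵐ u ∂ν, ‖h u‖ ≤ B) (y : E D) :
    Integrable (fun u => gaussianDensity y (α • h u) σ • h u) ν :=
  (integrable_gaussianDensity_comp hσ hm y).smul_bdd B hm.aestronglyMeasurable hb

lemma mixDensity_pos (hσ : 0 < σ) (hm : Measurable h) (y : E D) : 0 < mixDensity ν α σ h y := by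
  refine (integral_pos_iff_support_of_nonneg (fun u => (gaussianDensity_pos hσ _ _).le)
    (integrable_gaussianDensity_comp hσ hm y)).2 ?_
  have : Function.support (fun u => gaussianDensity y (α • h u) σ) = Set.univ :=
    Set.eq_univ_of_forall fun u => (gaussianDensity_pos hσ _ _).ne'
  simp [this]

lemma mixDensity_smul_postMean (hσ : 0 < σ) (hm : Measurable h) (y : E D) :
    mixDensity ν α σ h y • postMean ν α σ h y =
      ∫ u, gaussianDensity y (α • h u) σ • h u ∂ν :=
  smul_inv_smul₀ (mixDensity_pos hσ hm y).ne' _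

lemma norm_postMean_le (hσ : 0 < σ) (hm : Measurable h) (hb : ∀ᵐ u ∂ν, ‖h u‖ ≤ B) (y : E D) :
    ‖postMean ν α σ h y‖ ≤ B := by
  have hp := mixDensity_pos (ν := ν) (α := α) hσ hm y
  rw [postMean, norm_smul, norm_inv, Real.norm_of_nonneg hp.le, inv_mul_le_iff₀ hp, mixDensity,
    ← integral_mul_const]
  refine norm_integral_le_of_norm_le ((integrable_gaussianDensity_comp hσ hm y).mul_const B) ?_
  filter_upwards [hb] with u hu
  rw [norm_smul, Real.norm_of_nonneg (gaussianDensity_pos hσ _ _).le]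
  exact mul_le_mul_of_nonneg_left hu (gaussianDensity_pos hσ _ _).le

lemma measurable_postMean (hm : Measurable h) : Measurable (postMean ν α σ h) := by
  have h1 : StronglyMeasurable fun p : E D × 𝓤 => gaussianDensity p.1 (α • h p.2) σ :=
    (measurable_gaussianDensity_comp σ α hm).stronglyMeasurable
  have h2 : StronglyMeasurable fun p : E D × 𝓤 =>
      gaussianDensity p.1 (α • h p.2) σ • h p.2 :=
    h1.smul (hm.comp measurable_snd).stronglyMeasurable
  exact (h1.integral_prod_right'.measurable.inv).smul h2.integral_prod_right'.measurable

/-- Tweedie's formula, by differentiating under the integral. On the unit ball around `y` the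
derivative of the integrand is bounded by a constant, which is integrable for a probability measure.
-/
lemma hasGradientAt_mixDensity (hσ : 0 < σ) (hm : Measurable h) (hb : ∀ᵐ u ∂ν, ‖h u‖ ≤ B)
    (y : E D) :
    HasGradientAt (mixDensity ν α σ h)
      ((mixDensity ν α σ h y * (1 / σ ^ 2)) • (α • postMean ν α σ h y - y)) y := by
  set C := (2 * Real.pi * σ ^ 2) ^ (-(D : ℝ) / 2) with hC
  have hg := integrable_gaussianDensity_comp (ν := ν) (α := α) hσ hm y
  have hgh := integrable_gaussianDensity_smul (α := α) hσ hm hb y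
  have hvm : Measurable fun u =>
      (gaussianDensity y (α • h u) σ * (1 / σ ^ 2)) • (α • h u - y) :=
    ((((measurable_gaussianDensity_comp σ α hm).comp measurable_prodMk_left).mul_const _).smul
      ((hm.const_smul α).sub_const y))
  have hderiv := hasFDerivAt_integral_of_dominated_of_fderiv_le (μ := ν) (𝕜 := ℝ)
    (F := fun y u => gaussianDensity y (α • h u) σ)
    (F' := fun y u => (gaussianDensity y (α • h u) σ * (1 / σ ^ 2)) • innerSL ℝ (α • h u - y))
    (x₀ := y) (s := Metric.ball y 1) (bound := fun _ => C * (1 / σ ^ 2) * (|α| * B + (‖y‖ + 1)))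
    (Metric.ball_mem_nhds y one_pos)
    (Filter.Eventually.of_forall fun y' => (integrable_gaussianDensity_comp hσ hm y').1) hg
    ?_ ?_ (integrable_const _)
    (Filter.Eventually.of_forall fun u y' _ => hasFDerivAt_gaussianDensity _ _)
  · rw [hasGradientAt_iff_hasFDerivAt]
    refine hderiv.congr_fderiv ?_
    have hlin : ∀ u, (gaussianDensity y (α • h u) σ * (1 / σ ^ 2)) • innerSL ℝ (α • h u - y) =
        innerSL ℝ ((α / σ ^ 2) • (gaussianDensity y (α • h u) σ • h u) -
          gaussianDensity y (α • h u) σ • ((1 / σ ^ 2) • y)) := by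
      intro u
      rw [← map_smul]
      congr 1
      module
    have hi1 : Integrable (fun u => (α / σ ^ 2) • (gaussianDensity y (α • h u) σ • h u)) ν :=
      hgh.smul (α / σ ^ 2)
    have hi2 : Integrable (fun u => gaussianDensity y (α • h u) σ • ((1 / σ ^ 2) • y)) ν :=
      hg.smul_const _
    have hi3 : Integrable (fun u => (α / σ ^ 2) • (gaussianDensity y (α • h u) σ • h u) -
        gaussianDensity y (α • h u) σ • ((1 / σ ^ 2) • y)) ν := hi1.sub hi2
    simp only [hlin]
    rw [ContinuousLinearMap.integral_comp_comm _ hi3, integral_sub hi1 hi2,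
      integral_smul, integral_smul_const,
      ← mixDensity_smul_postMean hσ hm y]
    change innerSL ℝ _ = innerSL ℝ _
    congr 1
    simp only [mixDensity]
    module
  · have := (innerSL ℝ (E := E D)).continuous.measurable.comp hvm
    refine AEStronglyMeasurable.congr this.aestronglyMeasurable
      (Filter.Eventually.of_forall fun u => ?_)
    simp only [Function.comp_apply, map_smul]
  · filter_upwards [hb] with u hu y' hy'
    have hg0 := gaussianDensity_pos hσ y' (α • h u)
    rw [norm_smul, innerSL_apply_norm, Real.norm_of_nonneg (by positivity)]
    have hy1 : ‖y'‖ ≤ ‖y‖ + 1 := by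
      have h1 : ‖y' - y‖ < 1 := by simpa [dist_eq_norm] using hy'
      have h2 := norm_le_norm_add_norm_sub' y' y
      linarith
    have h3 : ‖α • h u - y'‖ ≤ |α| * B + (‖y‖ + 1) := by
      refine (norm_sub_le _ _).trans (add_le_add ?_ hy1)
      rw [norm_smul, Real.norm_eq_abs]
      gcongr
    have h4 := gaussianDensity_le (σ := σ) y' (α • h u)
    have h5 : 0 ≤ C := hg0.le.trans h4
    gcongr

end Score

/-! ### Score and loss in terms of the posterior mean. -/

section Loss
variable {d D : ℕ} {π : E d → ℝ} {𝒰 : Set (E d)} {α σ B : ℝ} {h : E d → E D}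

lemma score_eq (hπ : IsLatentDensity π 𝒰) (hσ : 0 < σ) (hm : Measurable h)
    (hb : ∀ u ∈ 𝒰, ‖h u‖ ≤ B) (y : E D) :
    score α σ π h y = (1 / σ ^ 2) • (α • postMean (latentLaw π) α σ h y - y) := by
  have := hπ.isProbabilityMeasure
  have hb' : ∀ᵐ u ∂(latentLaw π), ‖h u‖ ≤ B := hπ.ae_mem.mono fun u hu => hb u hu.1
  have h1 : smoothedDensity α σ π h = mixDensity (latentLaw π) α σ h :=
    funext fun y => hπ.integral_mul_eq _
  have hp := mixDensity_pos (ν := latentLaw π) (α := α) hσ hm y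
  have h2 := (hasGradientAt_mixDensity (α := α) hσ hm hb' y).hasFDerivAt.log hp.ne'
  rw [score, h1]
  refine HasGradientAt.gradient ?_
  rw [hasGradientAt_iff_hasFDerivAt]
  refine h2.congr_fderiv ?_
  rw [← map_smul, smul_smul]
  congr 2
  field_simp

/-- The terms `-y/σ²` of the two scores cancel. -/
lemma loss_eq (hπ : IsLatentDensity π 𝒰) (hσ : 0 < σ) (hm : Measurable h)
    (hb : ∀ u ∈ 𝒰, ‖h u‖ ≤ B) (x : E D × E D) :
    loss α σ π h x =
      (α / σ ^ 2) ^ 2 * ‖postMean (latentLaw π) α σ h x.1 - x.2‖ ^ 2 := by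
  rw [loss, score_eq hπ hσ hm hb, condScore_eq hσ, ← smul_sub, sub_sub_sub_cancel_right,
    ← smul_sub, smul_smul, norm_smul, mul_pow, Real.norm_eq_abs, sq_abs]
  congr 2
  ring

end Loss

/-! ### The data law and the excess risk -/

section Risk
variable {d D : ℕ} {π : E d → ℝ} {𝒰 : Set (E d)} {α σ B : ℝ} {hstar h : E d → E D}

lemma measurable_dataMap (α σ : ℝ) (hm : Measurable hstar) :
    Measurable fun p : E d × E D => (α • hstar p.1 + σ • p.2, hstar p.1) := by
  fun_prop

lemma isProbabilityMeasure_dataLaw (hπ : IsLatentDensity π 𝒰) (hm : Measurable hstar) :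
    IsProbabilityMeasure (dataLaw α σ π hstar) := by
  have := hπ.isProbabilityMeasure
  exact Measure.isProbabilityMeasure_map (measurable_dataMap α σ hm).aemeasurable

/-- The closure replaces the manifold because an image under a merely measurable map need not be
measurable, and measurability is used to pull the statement back to the latent variables. -/
lemma ae_dataLaw (hπ : IsLatentDensity π 𝒰) (hm : Measurable hstar)
    (hb : ∀ u ∈ 𝒰, ‖hstar u‖ ≤ B) :
    ∀ᵐ x ∂(dataLaw α σ π hstar), ‖x.2‖ ≤ B ∧ x.2 ∈ closure (targetManifold 𝒰 π hstar) := by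
  have := hπ.isProbabilityMeasure
  have hset : MeasurableSet
      {x : E D × E D | ‖x.2‖ ≤ B ∧ x.2 ∈ closure (targetManifold 𝒰 π hstar)} :=
    (measurableSet_le measurable_snd.norm measurable_const).inter
      (measurable_snd isClosed_closure.measurableSet)
  rw [dataLaw, ae_map_iff (measurable_dataMap α σ hm).aemeasurable hset]
  filter_upwards [Measure.quasiMeasurePreserving_fst.ae hπ.ae_mem] with p hp
  exact ⟨hb _ hp.1, subset_closure ⟨p.1, hp, rfl⟩⟩

lemma measurable_gaussianDensity_prod {𝓤 : Type*} [MeasurableSpace 𝓤] {h : 𝓤 → E D}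
    (hm : Measurable h) :
    Measurable fun p : 𝓤 × E D => gaussianDensity p.2 (α • h p.1) σ := by
  unfold gaussianDensity
  fun_prop

lemma integrable_gaussianDensity_prod {𝓤 : Type*} [MeasurableSpace 𝓤] {ν : Measure 𝓤}
    [IsProbabilityMeasure ν] {h : 𝓤 → E D} (hσ : 0 < σ) (hm : Measurable h) :
    Integrable (fun p : 𝓤 × E D => gaussianDensity p.2 (α • h p.1) σ) (ν.prod volume) := by
  have h1 : Measurable fun p : 𝓤 × E D => gaussianDensity p.2 (α • h p.1) σ :=
    measurable_gaussianDensity_prod hm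
  rw [integrable_prod_iff h1.aestronglyMeasurable]
  refine ⟨Filter.Eventually.of_forall fun u => integrable_gaussianDensity hσ (α • h u), ?_⟩
  have h2 : ∀ u, ∫ y, ‖gaussianDensity y (α • h u) σ‖ = 1 := fun u => by
    simp only [Real.norm_of_nonneg (gaussianDensity_pos hσ _ _).le]
    exact integral_gaussianDensity hσ (α • h u)
  simp only [h2]
  exact integrable_const _

/-- `m_*(Y_t)` is the conditional mean of `Y_0` given `Y_t`. -/
theorem integral_inner_sub_postMean_eq_zero (hπ : IsLatentDensity π 𝒰) (hσ : 0 < σ)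
    (hm : Measurable hstar) (hb : ∀ u ∈ 𝒰, ‖hstar u‖ ≤ B) {ψ : E D → E D} (hψ : Measurable ψ)
    {C : ℝ} (hψC : ∀ y, ‖ψ y‖ ≤ C) :
    ∫ x, inner ℝ (ψ x.1) (x.2 - postMean (latentLaw π) α σ hstar x.1) ∂(dataLaw α σ π hstar) =
      0 := by
  have := hπ.isProbabilityMeasure
  have hb' : ∀ᵐ u ∂(latentLaw π), ‖hstar u‖ ≤ B := hπ.ae_mem.mono fun u hu => hb u hu.1
  set m := postMean (latentLaw π) α σ hstar with hmdef
  have hmm : Measurable m := measurable_postMean hm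
  have hmB : ∀ y, ‖m y‖ ≤ B := norm_postMean_le hσ hm hb'
  have hC : 0 ≤ C := (norm_nonneg _).trans (hψC 0)
  set F : E D × E D → ℝ := fun x => inner ℝ (ψ x.1) (x.2 - m x.1) with hF
  have hFm : Measurable F := by
    simp only [hF]
    fun_prop
  have hFb : ∀ x : E D × E D, ‖x.2‖ ≤ B → ‖F x‖ ≤ C * (B + B) := by
    intro x hx
    refine (norm_inner_le_norm _ _).trans ?_
    have h1 : ‖x.2 - m x.1‖ ≤ B + B := (norm_sub_le _ _).trans (add_le_add hx (hmB _))
    have h2 := hψC x.1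
    gcongr
  have hdm := measurable_dataMap (hstar := hstar) α σ hm
  have hint : Integrable (fun p : E d × E D => F (α • hstar p.1 + σ • p.2, hstar p.1))
      ((latentLaw π).prod (stdGaussian (E D))) := by
    refine Integrable.of_bound (C := C * (B + B)) (hFm.comp hdm).aestronglyMeasurable ?_
    filter_upwards [Measure.quasiMeasurePreserving_fst.ae hb'] with p hp
    exact hFb _ hp
  rw [dataLaw, integral_map hdm.aemeasurable hFm.aestronglyMeasurable, integral_prod _ hint]
  have h1 : ∀ u, ∫ z, F (α • hstar u + σ • z, hstar u) ∂(stdGaussian (E D)) =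
      ∫ y, gaussianDensity y (α • hstar u) σ * F (y, hstar u) := fun u =>
    integral_stdGaussian_affine hσ (α • hstar u) (f := fun y => F (y, hstar u))
      (hFm.comp measurable_prodMk_right)
  simp only [h1]
  have hgint := integrable_gaussianDensity_prod (ν := latentLaw π) (α := α) hσ hm
  have hFm' : Measurable fun p : E d × E D => F (p.2, hstar p.1) :=
    hFm.comp (measurable_snd.prodMk (hm.comp measurable_fst))
  have hprod : Integrable (Function.uncurry fun (u : E d) (y : E D) =>
      gaussianDensity y (α • hstar u) σ * F (y, hstar u)) ((latentLaw π).prod volume) := by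
    refine hgint.mul_bdd (c := C * (B + B)) hFm'.aestronglyMeasurable ?_
    filter_upwards [Measure.quasiMeasurePreserving_fst.ae hb'] with p hp
    exact hFb _ hp
  -- With `y` fixed and the latent variable integrated first, the integrand becomes the inner
  -- product of `ψ y` with `∫ g h* - (∫ g) m(y)`, where `g` is the Gaussian weight; this vanishes by
  -- the definition of `m`.
  rw [integral_integral_swap hprod]
  refine integral_eq_zero_of_ae (Filter.Eventually.of_forall fun y => ?_)
  have hg := integrable_gaussianDensity_comp (ν := latentLaw π) (α := α) hσ hm y
  have hgh := integrable_gaussianDensity_smul (α := α) hσ hm hb' y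
  have h3 : ∀ u, gaussianDensity y (α • hstar u) σ * F (y, hstar u) =
      inner ℝ (ψ y) (gaussianDensity y (α • hstar u) σ • hstar u -
        gaussianDensity y (α • hstar u) σ • m y) := fun u => by
    rw [← smul_sub, real_inner_smul_right]
  have hi : Integrable (fun u => gaussianDensity y (α • hstar u) σ • hstar u -
      gaussianDensity y (α • hstar u) σ • m y) (latentLaw π) := hgh.sub (hg.smul_const _)
  simp only [h3, Pi.zero_apply]
  rw [integral_inner hi, integral_sub hgh (hg.smul_const _), integral_smul_const,
    ← mixDensity_smul_postMean hσ hm y]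
  simp [mixDensity, hmdef]

/-- The excess loss `ℓ(·; h) - ℓ(·; h*)`. -/
def excessLoss (α σ : ℝ) (π : E d → ℝ) (hstar h : E d → E D) (x : E D × E D) : ℝ :=
  loss α σ π h x - loss α σ π hstar x

lemma measurable_loss (hπ : IsLatentDensity π 𝒰) (hσ : 0 < σ) (hm : Measurable h)
    (hb : ∀ u ∈ 𝒰, ‖h u‖ ≤ B) : Measurable (loss α σ π h) := by
  have := hπ.isProbabilityMeasure
  have hmm : Measurable (postMean (latentLaw π) α σ h) := measurable_postMean hm
  rw [funext fun x => loss_eq (α := α) hπ hσ hm hb x]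
  fun_prop

lemma loss_le (hπ : IsLatentDensity π 𝒰) (hσ : 0 < σ) (hm : Measurable h)
    (hb : ∀ u ∈ 𝒰, ‖h u‖ ≤ B) {x : E D × E D} (hx : ‖x.2‖ ≤ B) :
    loss α σ π h x ≤ 4 * (α * B / σ ^ 2) ^ 2 := by
  have := hπ.isProbabilityMeasure
  have h1 := norm_postMean_le (α := α) hσ hm (hπ.ae_mem.mono fun u hu => hb u hu.1) x.1
  rw [loss_eq hπ hσ hm hb]
  have h2 : ‖postMean (latentLaw π) α σ h x.1 - x.2‖ ≤ 2 * B :=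
    (norm_sub_le _ _).trans (by linarith)
  calc _ ≤ (α / σ ^ 2) ^ 2 * (2 * B) ^ 2 := by gcongr
    _ = _ := by ring

lemma loss_nonneg (x : E D × E D) : 0 ≤ loss α σ π h x := sq_nonneg _

lemma abs_excessLoss_le (hπ : IsLatentDensity π 𝒰) (hσ : 0 < σ) (hm : Measurable h)
    (hb : ∀ u ∈ 𝒰, ‖h u‖ ≤ B) (hms : Measurable hstar) (hbs : ∀ u ∈ 𝒰, ‖hstar u‖ ≤ B)
    {x : E D × E D} (hx : ‖x.2‖ ≤ B) :
    |excessLoss α σ π hstar h x| ≤ 4 * (α * B / σ ^ 2) ^ 2 := by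
  have h1 := loss_le (α := α) hπ hσ hm hb hx
  have h2 := loss_le (α := α) hπ hσ hms hbs hx
  have h3 := loss_nonneg (α := α) (σ := σ) (π := π) (h := h) x
  have h4 := loss_nonneg (α := α) (σ := σ) (π := π) (h := hstar) x
  rw [excessLoss, abs_le]
  constructor <;> linarith

lemma memLp_excessLoss (hπ : IsLatentDensity π 𝒰) (hσ : 0 < σ) (hm : Measurable h)
    (hb : ∀ u ∈ 𝒰, ‖h u‖ ≤ B) (hms : Measurable hstar) (hbs : ∀ u ∈ 𝒰, ‖hstar u‖ ≤ B) :
    MemLp (excessLoss α σ π hstar h) 2 (dataLaw α σ π hstar) := by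
  have := isProbabilityMeasure_dataLaw (α := α) (σ := σ) hπ hms
  refine MemLp.of_bound ((measurable_loss hπ hσ hm hb).sub
    (measurable_loss hπ hσ hms hbs)).aestronglyMeasurable (4 * (α * B / σ ^ 2) ^ 2) ?_
  filter_upwards [ae_dataLaw hπ hms hbs] with x hx
  exact abs_excessLoss_le hπ hσ hm hb hms hbs hx.1

lemma integrable_loss (hπ : IsLatentDensity π 𝒰) (hσ : 0 < σ) (hm : Measurable h)
    (hb : ∀ u ∈ 𝒰, ‖h u‖ ≤ B) (hms : Measurable hstar) (hbs : ∀ u ∈ 𝒰, ‖hstar u‖ ≤ B) :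
    Integrable (loss α σ π h) (dataLaw α σ π hstar) := by
  have := isProbabilityMeasure_dataLaw (α := α) (σ := σ) hπ hms
  refine Integrable.of_bound (C := 4 * (α * B / σ ^ 2) ^ 2)
    (measurable_loss hπ hσ hm hb).aestronglyMeasurable ?_
  filter_upwards [ae_dataLaw hπ hms hbs] with x hx
  rw [Real.norm_of_nonneg (loss_nonneg x)]
  exact loss_le hπ hσ hm hb hx.1

lemma rhoSq_eq_integral_excessLoss (hπ : IsLatentDensity π 𝒰) (hσ : 0 < σ) (hm : Measurable h)
    (hb : ∀ u ∈ 𝒰, ‖h u‖ ≤ B) (hms : Measurable hstar) (hbs : ∀ u ∈ 𝒰, ‖hstar u‖ ≤ B) :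
    rhoSq α σ π hstar h = ∫ x, excessLoss α σ π hstar h x ∂(dataLaw α σ π hstar) :=
  (integral_sub (integrable_loss hπ hσ hm hb hms hbs)
    (integrable_loss hπ hσ hms hbs hms hbs)).symm

lemma integrable_sq_postMean_sub (hπ : IsLatentDensity π 𝒰) (hσ : 0 < σ) (hm : Measurable h)
    (hb : ∀ u ∈ 𝒰, ‖h u‖ ≤ B) (hms : Measurable hstar) (hbs : ∀ u ∈ 𝒰, ‖hstar u‖ ≤ B) :
    Integrable (fun x : E D × E D => ‖postMean (latentLaw π) α σ h x.1 -
      postMean (latentLaw π) α σ hstar x.1‖ ^ 2) (dataLaw α σ π hstar) := by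
  have := hπ.isProbabilityMeasure
  have := isProbabilityMeasure_dataLaw (α := α) (σ := σ) hπ hms
  have h1 : Measurable (postMean (latentLaw π) α σ h) := measurable_postMean hm
  have h2 : Measurable (postMean (latentLaw π) α σ hstar) := measurable_postMean hms
  refine Integrable.of_bound (C := (B + B) ^ 2) (Measurable.aestronglyMeasurable (by fun_prop))
    (Filter.Eventually.of_forall fun x => ?_)
  rw [Real.norm_of_nonneg (sq_nonneg _)]
  have h3 := norm_postMean_le (α := α) hσ hm (hπ.ae_mem.mono fun u hu => hb u hu.1) x.1
  have h4 := norm_postMean_le (α := α) hσ hms (hπ.ae_mem.mono fun u hu => hbs u hu.1) x.1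
  have h5 := (norm_sub_le (postMean (latentLaw π) α σ h x.1)
    (postMean (latentLaw π) α σ hstar x.1)).trans (add_le_add h3 h4)
  gcongr

/-- Pythagoras: in the expansion of `‖p - y₀‖²` around `q = m_{h*}(y_t)`, the cross term has mean
zero because `p - q` depends on `y_t` only. -/
lemma rhoSq_eq (hπ : IsLatentDensity π 𝒰) (hσ : 0 < σ) (hm : Measurable h)
    (hb : ∀ u ∈ 𝒰, ‖h u‖ ≤ B) (hms : Measurable hstar) (hbs : ∀ u ∈ 𝒰, ‖hstar u‖ ≤ B) :
    rhoSq α σ π hstar h = (α / σ ^ 2) ^ 2 *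
      ∫ x, ‖postMean (latentLaw π) α σ h x.1 - postMean (latentLaw π) α σ hstar x.1‖ ^ 2
        ∂(dataLaw α σ π hstar) := by
  have := hπ.isProbabilityMeasure
  have hiE := (memLp_excessLoss (α := α) hπ hσ hm hb hms hbs)
  have := isProbabilityMeasure_dataLaw (α := α) (σ := σ) hπ hms
  have hiE := hiE.integrable (by norm_num)
  have hiS := integrable_sq_postMean_sub (α := α) hπ hσ hm hb hms hbs
  have h1 : Measurable (postMean (latentLaw π) α σ h) := measurable_postMean hm
  have h2 : Measurable (postMean (latentLaw π) α σ hstar) := measurable_postMean hms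
  have h0 := integral_inner_sub_postMean_eq_zero (α := α) hπ hσ hms hbs (h1.sub h2)
    (C := B + B) (fun y => (norm_sub_le _ _).trans (add_le_add
      (norm_postMean_le (α := α) hσ hm (hπ.ae_mem.mono fun u hu => hb u hu.1) y)
      (norm_postMean_le (α := α) hσ hms (hπ.ae_mem.mono fun u hu => hbs u hu.1) y)))
  rw [rhoSq_eq_integral_excessLoss hπ hσ hm hb hms hbs, ← integral_const_mul, ← sub_eq_zero,
    ← integral_sub hiE (hiS.const_mul _)]
  -- The right-hand zero is written as a multiple of the cross term, which reduces the claim to a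
  -- pointwise identity.
  rw [← mul_eq_zero_of_right (-2 * (α / σ ^ 2) ^ 2) h0, ← integral_const_mul]
  refine integral_congr_ae (Filter.Eventually.of_forall fun x => ?_)
  simp only [excessLoss, Pi.sub_apply]
  rw [loss_eq hπ hσ hm hb, loss_eq hπ hσ hms hbs]
  generalize postMean (latentLaw π) α σ h x.1 = p
  generalize postMean (latentLaw π) α σ hstar x.1 = q
  have h3 : ‖p - x.2‖ ^ 2 = ‖p - q‖ ^ 2 - 2 * inner ℝ (p - q) (x.2 - q) + ‖x.2 - q‖ ^ 2 := by
    rw [← norm_sub_sq_real, sub_sub_sub_cancel_right]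
  rw [h3, norm_sub_rev q x.2]
  ring

lemma rhoSq_le (hπ : IsLatentDensity π 𝒰) (hσ : 0 < σ) (hm : Measurable h)
    (hb : ∀ u ∈ 𝒰, ‖h u‖ ≤ B) (hms : Measurable hstar) (hbs : ∀ u ∈ 𝒰, ‖hstar u‖ ≤ B) :
    rhoSq α σ π hstar h ≤ 4 * (α * B / σ ^ 2) ^ 2 := by
  have := isProbabilityMeasure_dataLaw (α := α) (σ := σ) hπ hms
  rw [rhoSq_eq_integral_excessLoss hπ hσ hm hb hms hbs]
  have h1 := integral_mono_ae ((memLp_excessLoss (α := α) hπ hσ hm hb hms hbs).integrable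
    (by norm_num)) (integrable_const (4 * (α * B / σ ^ 2) ^ 2))
    ((ae_dataLaw (α := α) (σ := σ) hπ hms hbs).mono fun x hx =>
      (le_abs_self _).trans (abs_excessLoss_le hπ hσ hm hb hms hbs hx.1))
  simpa using h1

/-- The variance of the excess loss is dominated by the excess risk. -/
lemma integral_sq_excessLoss_le (hπ : IsLatentDensity π 𝒰) (hσ : 0 < σ)
    (hm : Measurable h) (hb : ∀ u ∈ 𝒰, ‖h u‖ ≤ B) (hms : Measurable hstar)
    (hbs : ∀ u ∈ 𝒰, ‖hstar u‖ ≤ B) :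
    ∫ x, excessLoss α σ π hstar h x ^ 2 ∂(dataLaw α σ π hstar) ≤
      16 * (α * B / σ ^ 2) ^ 2 * rhoSq α σ π hstar h := by
  have := hπ.isProbabilityMeasure
  have hiS := integrable_sq_postMean_sub (α := α) hπ hσ hm hb hms hbs
  rw [rhoSq_eq hπ hσ hm hb hms hbs, ← mul_assoc, ← integral_const_mul]
  refine integral_mono_ae (memLp_excessLoss (α := α) hπ hσ hm hb hms hbs).integrable_sq
    (hiS.const_mul _) ?_
  filter_upwards [ae_dataLaw hπ hms hbs] with x hx
  have h3 := norm_postMean_le (α := α) hσ hm (hπ.ae_mem.mono fun u hu => hb u hu.1) x.1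
  have h4 := norm_postMean_le (α := α) hσ hms (hπ.ae_mem.mono fun u hu => hbs u hu.1) x.1
  simp only [excessLoss]
  rw [loss_eq hπ hσ hm hb, loss_eq hπ hσ hms hbs]
  generalize postMean (latentLaw π) α σ h x.1 = p at *
  generalize postMean (latentLaw π) α σ hstar x.1 = q at *
  -- The difference of squares factors into a difference bounded by `‖p - q‖` and a sum bounded by
  -- `4B`.
  have h5 : |‖p - x.2‖ - ‖q - x.2‖| ≤ ‖p - q‖ := by
    simpa using abs_norm_sub_norm_le (p - x.2) (q - x.2)
  have h6 : ‖p - x.2‖ + ‖q - x.2‖ ≤ 4 * B := by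
    have := norm_sub_le p x.2
    have := norm_sub_le q x.2
    linarith [hx.1]
  have h7 : (‖p - x.2‖ - ‖q - x.2‖) ^ 2 ≤ ‖p - q‖ ^ 2 := by
    rw [← sq_abs]
    exact pow_le_pow_left₀ (abs_nonneg _) h5 2
  calc _ = ((α / σ ^ 2) ^ 2) ^ 2 *
        ((‖p - x.2‖ - ‖q - x.2‖) ^ 2 * (‖p - x.2‖ + ‖q - x.2‖) ^ 2) := by ring
    _ ≤ ((α / σ ^ 2) ^ 2) ^ 2 * (‖p - q‖ ^ 2 * (4 * B) ^ 2) := by gcongr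
    _ = _ := by ring

end Risk

/-! ### Bracketing entropy along dyadic scales -/

section Entropy
variable {𝓧 : Type*} [MeasurableSpace 𝓧] {P : Measure 𝓧} {F : Set (𝓧 → ℝ)}

lemma HasBracketCover.mono {F' : Set (𝓧 → ℝ)} {δ δ' : ℝ} {m : ℕ} (h : HasBracketCover P F δ m)
    (hF : F' ⊆ F) (hδ : δ ≤ δ') : HasBracketCover P F' δ' m := by
  obtain ⟨lo, up, h1, h2⟩ := h
  exact ⟨lo, up, fun j => ⟨(h1 j).1, (h1 j).2.1,
    (h1 j).2.2.trans (ENNReal.ofReal_le_ofReal hδ)⟩, fun f hf => h2 f (hF hf)⟩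

lemma antitone_bracketingEntropy : Antitone (bracketingEntropy P F) := by
  intro δ δ' hδ
  refine EReal.toENNReal_le_toENNReal (ENNReal.log_monotone ?_)
  have : bracketingNumber P F δ' ≤ bracketingNumber P F δ := by
    refine sInf_le_sInf ?_
    rintro N ⟨m, rfl, hm⟩
    exact ⟨m, rfl, hm.mono subset_rfl hδ⟩
  exact_mod_cast this

lemma hasBracketCover_toNat {δ : ℝ} (h : bracketingEntropy P F δ ≠ ⊤) :
    ((bracketingNumber P F δ).toNat : ℕ∞) = bracketingNumber P F δ ∧
      HasBracketCover P F δ (bracketingNumber P F δ).toNat := by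
  have hne : bracketingNumber P F δ ≠ ⊤ := by
    intro h'
    apply h
    simp [bracketingEntropy, h']
  have hS : {N : ℕ∞ | ∃ m : ℕ, N = m ∧ HasBracketCover P F δ m}.Nonempty := by
    by_contra hcon
    rw [Set.not_nonempty_iff_eq_empty] at hcon
    apply hne
    rw [bracketingNumber, hcon, sInf_empty]
  obtain ⟨m, hm, hcov⟩ := csInf_mem hS
  have hm' : bracketingNumber P F δ = m := hm
  rw [hm', ENat.toNat_natCast]
  exact ⟨rfl, hcov⟩

lemma HasBracketCover.one_le {δ : ℝ} {m : ℕ} (h : HasBracketCover P F δ m) (hF : F.Nonempty) :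
    1 ≤ m := by
  obtain ⟨lo, up, -, h2⟩ := h
  obtain ⟨f, hf⟩ := hF
  obtain ⟨j, -⟩ := h2 f hf
  exact Nat.one_le_of_lt j.2

lemma ofReal_sqrt_log_eq {δ : ℝ} (h : bracketingEntropy P F δ ≠ ⊤) (hF : F.Nonempty) :
    ENNReal.ofReal √(Real.log (bracketingNumber P F δ).toNat) =
      bracketingEntropy P F δ ^ (1 / 2 : ℝ) := by
  obtain ⟨h1, h2⟩ := hasBracketCover_toNat h
  have h3 := h2.one_le hF
  rw [bracketingEntropy, ← h1]
  generalize (bracketingNumber P F δ).toNat = m at h3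
  have h3' : (1 : ℝ) ≤ m := by exact_mod_cast h3
  have h4 : ENNReal.log ((m : ℕ∞) : ℝ≥0∞) = (Real.log m : ℝ) := by
    have : (((m : ℕ∞) : ℝ≥0∞)) = ENNReal.ofReal m := by simp
    rw [this, ENNReal.log_ofReal_of_pos (by linarith)]
  rw [h4, ENat.toNat_natCast, Real.sqrt_eq_rpow, ← ENNReal.ofReal_rpow_of_nonneg (Real.log_nonneg h3') (by norm_num)]
  simp

/-- On each dyadic cell an antitone function is at least its value at the right endpoint. The scale
`L` itself therefore never enters, and covers are obtained only from `2L` upwards. -/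
lemma sum_dyadic_le_lintegral {G : ℝ → ℝ≥0∞} (hG : Antitone G) {L : ℝ} (hL : 0 < L) (M : ℕ) :
    ∑ m ∈ Finset.range M, ENNReal.ofReal (2 ^ m * L) * G (2 ^ (m + 1) * L) ≤
      ∫⁻ u in Set.Ioc L (2 ^ M * L), G u := by
  induction M with
  | zero => simp
  | succ M ih =>
    have h1 : L ≤ 2 ^ M * L := le_mul_of_one_le_left hL.le (one_le_pow₀ (by norm_num))
    have h2 : (2 : ℝ) ^ M * L ≤ 2 ^ (M + 1) * L := by
      rw [pow_succ]; nlinarith [pow_pos (two_pos : (0 : ℝ) < 2) M]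
    rw [Finset.sum_range_succ, ← Set.Ioc_union_Ioc_eq_Ioc h1 h2,
      lintegral_union measurableSet_Ioc (Set.Ioc_disjoint_Ioc_of_le le_rfl)]
    refine add_le_add ih ?_
    calc ENNReal.ofReal (2 ^ M * L) * G (2 ^ (M + 1) * L)
        = ∫⁻ _u in Set.Ioc (2 ^ M * L) (2 ^ (M + 1) * L), G (2 ^ (M + 1) * L) := by
          rw [setLIntegral_const, Real.volume_Ioc, mul_comm, pow_succ]
          congr 2
          ring
      _ ≤ _ := setLIntegral_mono' measurableSet_Ioc fun u hu => hG hu.2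

/-- Finiteness of the entropy integral gives bracket covers at all dyadic scales, with a bound on
the corresponding Riemann sum. -/
lemma exists_dyadic_covers (hF : F.Nonempty) {L c : ℝ} (hL : 0 < L) (hc : 0 ≤ c) (M : ℕ)
    (h : ∫⁻ u in Set.Ioc L (2 ^ M * L), bracketingEntropy P F u ^ (1 / 2 : ℝ) ≤
      ENNReal.ofReal c) :
    ∃ N : ℕ → ℕ, (∀ m, 1 ≤ m → m ≤ M → HasBracketCover P F (2 ^ m * L) (N m)) ∧
      ∑ m ∈ Finset.range M, 2 ^ m * L * √(Real.log (N (m + 1))) ≤ c := by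
  have hG : Antitone fun u => bracketingEntropy P F u ^ (1 / 2 : ℝ) := fun u v huv =>
    ENNReal.rpow_le_rpow (antitone_bracketingEntropy huv) (by norm_num)
  have h1 := (sum_dyadic_le_lintegral hG hL M).trans h
  have h2 : ∀ m < M, bracketingEntropy P F (2 ^ (m + 1) * L) ≠ ⊤ := by
    intro m hm htop
    have h3 := (Finset.single_le_sum (f := fun m => ENNReal.ofReal (2 ^ m * L) *
      bracketingEntropy P F (2 ^ (m + 1) * L) ^ (1 / 2 : ℝ)) (fun _ _ => zero_le)
      (Finset.mem_range.2 hm)).trans h1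
    rw [htop, ENNReal.top_rpow_of_pos (by norm_num), ENNReal.mul_top] at h3
    · exact ENNReal.ofReal_ne_top (top_le_iff.1 h3)
    · exact (ENNReal.ofReal_pos.2 (by positivity)).ne'
  refine ⟨fun m => (bracketingNumber P F (2 ^ m * L)).toNat, fun m hm hmM => ?_, ?_⟩
  · obtain ⟨m, rfl⟩ := Nat.exists_eq_add_of_le' hm
    exact (hasBracketCover_toNat (h2 m (by omega))).2
  · rw [← ENNReal.ofReal_le_ofReal_iff hc, ENNReal.ofReal_sum_of_nonneg fun m _ => by positivity]
    refine le_of_eq_of_le (Finset.sum_congr rfl fun m hm => ?_) h1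
    rw [ENNReal.ofReal_mul (by positivity),
      ofReal_sqrt_log_eq (h2 m (Finset.mem_range.1 hm)) hF]

end Entropy

/-! ### Peeling -/

section Peeling
variable {𝓧 Ω : Type*} [MeasurableSpace 𝓧] [MeasurableSpace Ω]

/-- One family of covers, at the scales `2^m L` with `L = kε²/16`, serves every shell. On shell `i`
each cover is used at a width `2^i` times its own: the entropy sum grows by `2^i`, while the
allowance `√n s²` with `s = 2^i ε` grows by `4^i`. -/
theorem measure_dyadic_shell_le {P : Measure 𝓧} [IsProbabilityMeasure P]
    {μ : Measure Ω} [IsProbabilityMeasure μ] {n : ℕ} {X : Fin n → Ω → 𝓧}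
    (hind : iIndepFun X μ) (hX : ∀ i, HasLaw (X i) P μ) {F : Set (𝓧 → ℝ)} {a ε k : ℝ}
    (ha : 0 < a) (hε : 0 < ε) (hk : 0 < k) (hk1 : k < 1) {M : ℕ}
    (hM₁ : a * ε / 2 ≤ 2 ^ M * (k * ε ^ 2 / 16)) (hM₂ : 2 ^ M * (k * ε ^ 2 / 16) ≤ a * ε)
    {N : ℕ → ℕ}
    (hcov : ∀ m, 1 ≤ m → m ≤ M → HasBracketCover P F (2 ^ m * (k * ε ^ 2 / 16)) (N m))
    (hsum : ∑ m ∈ Finset.range M, 2 ^ m * (k * ε ^ 2 / 16) * √(Real.log (N (m + 1))) ≤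
      √n * ε ^ 2 / 2048)
    {F' : Set (𝓧 → ℝ)} (hF' : F' ⊆ F) (hF'ne : F'.Nonempty) {i : ℕ} (hi : 2 ^ i * ε ≤ 2 * a)
    (hFb : ∀ᵐ x ∂P, ∀ f ∈ F', -(4 * a ^ 2) ≤ f x) (hFm : ∀ f ∈ F', MemLp f 2 P)
    (hFv : ∀ f ∈ F', ∫ x, f x ^ 2 ∂P ≤ (8 * a * (2 ^ i * ε)) ^ 2)
    {e : ℝ} (he : 0 ≤ e) (he' : e ≤ n * (2 ^ i * ε) ^ 2 / (20480 * a ^ 2)) :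
    ∃ J : ℕ,
      μ {ω | ∃ f ∈ F', 7 / 16 * (2 ^ i * ε) ^ 2 ≤ ∫ x, f x ∂P - empMean (fun i => X i ω) f} ≤
        ENNReal.ofReal (Real.exp (-e)) +
          ∑ j ∈ Finset.range J, ENNReal.ofReal (Real.exp (-((j + 2) * e))) := by
  set L := k * ε ^ 2 / 16 with hL
  have hL0 : 0 < L := by positivity
  have h2i : (1 : ℝ) ≤ 2 ^ i := one_le_pow₀ (by norm_num)
  have hiM : i + 2 ≤ M := by
    have h1 : (2 : ℝ) ^ (i + 2) ≤ 2 ^ M := by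
      rw [pow_add]
      have h2 : a * ε / 2 ≤ 2 ^ M * (ε ^ 2 / 16) := hM₁.trans (by
        rw [hL]
        gcongr
        nlinarith [sq_nonneg ε])
      have h3 : 2 ^ i * ε * ε ≤ 2 * a * ε := by gcongr
      have h4 : (2 ^ i * 2 ^ 2) * ε ^ 2 ≤ 2 ^ M * ε ^ 2 := by nlinarith
      exact le_of_mul_le_mul_right h4 (by positivity)
    exact (pow_le_pow_iff_right₀ (by norm_num)).1 h1
  have hscale : ∀ j ≤ M, (2 : ℝ) ^ (M + i) * L * (1 / 2) ^ j = 2 ^ i * (2 ^ (M - j) * L) := by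
    intro j hj
    have : (2 : ℝ) ^ M = 2 ^ (M - j) * 2 ^ j := by rw [← pow_add, Nat.sub_add_cancel hj]
    rw [pow_add, this, one_div, inv_pow]
    field_simp
  -- This `J` stops at the cover of index `i + 1`, where the width is `2^i · 2^(i+1) L = k s²/8 ≤
  -- s²/8`.
  refine ⟨M - i - 1, measure_shell_le (N := fun j => N (M - j)) (δ := 2 ^ (M + i) * L) hind hX ha
    (by positivity) hFb hFm hFv ?_ ?_ ?_ ?_ ?_ ?_ he he'⟩
  · rw [pow_add]
    nlinarith
  · rw [pow_add]
    nlinarith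
  · rw [hscale _ (by omega), show M - (M - i - 1) = i + 1 by omega, hL, pow_succ, mul_pow]
    have h1 : (0 : ℝ) < (2 ^ i) ^ 2 * ε ^ 2 := by positivity
    nlinarith
  · intro j hj
    exact ((hcov (M - j) (by omega) (by omega)).mono hF' le_rfl).one_le hF'ne
  · intro j hj
    refine (hcov (M - j) (by omega) (by omega)).mono hF' ?_
    rw [hscale j (by omega)]
    exact le_mul_of_one_le_left (by positivity) h2i
  · rw [show M - i - 1 + 1 = M - i by omega]
    calc ∑ j ∈ Finset.range (M - i), 2 ^ (M + i) * L * (1 / 2) ^ j * √(Real.log (N (M - j)))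
        ≤ ∑ j ∈ Finset.range M, 2 ^ (M + i) * L * (1 / 2) ^ j * √(Real.log (N (M - j))) :=
          Finset.sum_le_sum_of_subset_of_nonneg
            (Finset.range_subset_range.2 (Nat.sub_le _ _)) fun j _ _ => by positivity
      -- The extra factor `2` arises because the cover at `2^(m+1) L` is weighted in the Riemann sum
      -- by the cell length `2^m L`; it turns `2048` into `1024`.
      _ = ∑ j ∈ Finset.range M, 2 ^ (i + 1) *
            (2 ^ (M - 1 - j) * L * √(Real.log (N (M - 1 - j + 1)))) := by
          refine Finset.sum_congr rfl fun j hj => ?_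
          have hj' := Finset.mem_range.1 hj
          rw [hscale j hj'.le, show M - j = M - 1 - j + 1 by omega, pow_succ, pow_succ]
          ring
      _ = 2 ^ (i + 1) * ∑ m ∈ Finset.range M, 2 ^ m * L * √(Real.log (N (m + 1))) := by
          rw [← Finset.mul_sum, Finset.sum_range_reflect
            (fun m => 2 ^ m * L * √(Real.log (N (m + 1)))) M]
      _ ≤ 2 ^ (i + 1) * (√n * ε ^ 2 / 2048) := by gcongr
      _ = 2 ^ i * (√n * ε ^ 2 / 1024) := by rw [pow_succ]; ring
      _ ≤ (2 ^ i) ^ 2 * (√n * ε ^ 2 / 1024) := by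
          gcongr
          exact le_self_pow₀ h2i (by norm_num)
      _ = √n * (2 ^ i * ε) ^ 2 / 1024 := by ring

/-- With `q = exp (-e)`, the full series is `q + q²/(1 - q)`, at most `4q/3` when `q ≤ 1/4`. -/
lemma ofReal_exp_add_sum_le {e : ℝ} (he : Real.exp (-e) ≤ 1 / 4) (J : ℕ) :
    ENNReal.ofReal (Real.exp (-e)) +
        ∑ j ∈ Finset.range J, ENNReal.ofReal (Real.exp (-((j + 2) * e))) ≤
      ENNReal.ofReal (4 / 3 * Real.exp (-e)) := by
  set q := Real.exp (-e) with hq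
  have hq0 : 0 < q := Real.exp_pos _
  have h1 : ∀ j : ℕ, Real.exp (-((j + 2) * e)) = q ^ (j + 2) := fun j => by
    rw [hq, ← Real.exp_nat_mul]
    congr 1
    push_cast
    ring
  simp only [h1]
  rw [← ENNReal.ofReal_sum_of_nonneg fun j _ => by positivity,
    ← ENNReal.ofReal_add hq0.le (Finset.sum_nonneg fun j _ => by positivity)]
  refine ENNReal.ofReal_le_ofReal ?_
  have h2 : ∑ j ∈ Finset.range J, q ^ (j + 2) ≤ q / 3 := by
    have h3 : ∀ J : ℕ, ∑ j ∈ Finset.range J, q ^ (j + 2) ≤ q / 3 - q * q ^ J / 3 := by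
      intro J
      induction J with
      | zero => simp
      | succ J ih =>
        rw [Finset.sum_range_succ]
        have : q ^ (J + 2) ≤ q * q ^ J * (1 / 4) := by
          rw [pow_add, pow_two]
          have : 0 < q ^ J * q := by positivity
          nlinarith
        have h4 : q * q ^ (J + 1) ≤ q * q ^ J * (1 / 4) := by
          rw [pow_succ]
          have : 0 < q * q ^ J := by positivity
          nlinarith
        linarith
    have := h3 J
    have : 0 < q * q ^ J := by positivity
    linarith
  linarith

lemma tsum_ofReal_mul_pow_le {q : ℝ} (hq0 : 0 ≤ q) (hq : q ≤ 1 / 4) :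
    ∑' i : ℕ, ENNReal.ofReal (4 / 3 * q ^ (i + 1)) ≤ ENNReal.ofReal (16 / 9 * q) := by
  have hs : Summable fun i : ℕ => 4 / 3 * q ^ (i + 1) := by
    simp only [pow_succ']
    exact ((summable_geometric_of_lt_one hq0 (by linarith)).mul_left q).mul_left _
  rw [← ENNReal.ofReal_tsum_of_nonneg (fun i => by positivity) hs]
  refine ENNReal.ofReal_le_ofReal ?_
  simp only [pow_succ']
  rw [tsum_mul_left, tsum_mul_left, tsum_geometric_of_lt_one hq0 (by linarith)]
  have : (1 - q)⁻¹ ≤ 4 / 3 := by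
    rw [inv_le_comm₀ (by linarith) (by norm_num)]
    linarith
  nlinarith

end Peeling

/-! ### Anchor perturbation on the closure of the manifold. -/

section Anchor
variable {d D K : ℕ} {π : E d → ℝ} {𝒰 : Set (E d)} {α σ : ℝ}

/-- A uniform bound on the anchor perturbation extends to the closure of the target manifold. -/
lemma abs_anchorLoss_sub_loss_le_of_mem_closure (hσ : 0 < σ) {q : E D → E d → ℝ}
    {a : E D → Fin K → E d} {h : E d → E D} {y : E D} {T : Set (E D)} {c : ℝ}
    (hT : ∀ y₀ ∈ T, |anchorLoss α σ π q a h (y, y₀) - loss α σ π h (y, y₀)| ≤ c) :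
    ∀ y₀ ∈ closure T, |anchorLoss α σ π q a h (y, y₀) - loss α σ π h (y, y₀)| ≤ c := by
  refine closure_minimal (t := {y₀ | |anchorLoss α σ π q a h (y, y₀) - loss α σ π h (y, y₀)| ≤ c})
    hT (isClosed_le ?_ continuous_const)
  simp only [anchorLoss, loss, condScore_eq hσ]
  fun_prop

end Anchor

/-! ### Deviation events for the empirical minimizer. -/

section Minimizer
variable {d D : ℕ} {π : E d → ℝ} {𝒰 : Set (E d)} {α σ B : ℝ} {hstar : E d → E D}

/-- The upper deviation bound at a comparison map `h₀` with small excess risk. -/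
lemma measure_empMean_excessLoss_ge_le {Ω : Type*} [MeasurableSpace Ω] {μ : Measure Ω}
    [IsProbabilityMeasure μ] {n : ℕ} {X : Fin n → Ω → E D × E D} (hind : iIndepFun X μ)
    (hX : ∀ i, HasLaw (X i) (dataLaw α σ π hstar) μ)
    (hπ : IsLatentDensity π 𝒰) (hα : 0 < α) (hσ : 0 < σ) (hB : 0 < B) {h : E d → E D}
    (hm : Measurable h) (hb : ∀ u ∈ 𝒰, ‖h u‖ ≤ B) (hms : Measurable hstar)
    (hbs : ∀ u ∈ 𝒰, ‖hstar u‖ ≤ B) {ε : ℝ} (hε : 0 < ε)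
    (hh : rhoSq α σ π hstar h ≤ 9 / 32 * ε ^ 2) :
    μ {ω | ε ^ 2 / 32 ≤ empMean (fun i => X i ω) (excessLoss α σ π hstar h) -
        ∫ x, excessLoss α σ π hstar h x ∂(dataLaw α σ π hstar)} ≤
      ENNReal.ofReal (Real.exp (-(n * ε ^ 2 / (18432 * (α * B / σ ^ 2) ^ 2)))) := by
  have := isProbabilityMeasure_dataLaw (α := α) (σ := σ) hπ hms
  have ha : 0 < α * B / σ ^ 2 := by positivity
  refine (measure_empMean_sub_integral_ge_le hind hX (memLp_excessLoss hπ hσ hm hb hms hbs)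
    (b := 4 * (α * B / σ ^ 2) ^ 2) (V := 9 / 2 * (α * B / σ ^ 2) ^ 2 * ε ^ 2) (by positivity)
    (by positivity) ?_ ?_ ?_).trans (le_of_eq ?_)
  · filter_upwards [ae_dataLaw hπ hms hbs] with x hx
    exact (le_abs_self _).trans (abs_excessLoss_le hπ hσ hm hb hms hbs hx.1)
  · refine (integral_sq_excessLoss_le hπ hσ hm hb hms hbs).trans ?_
    calc 16 * (α * B / σ ^ 2) ^ 2 * rhoSq α σ π hstar h
        ≤ 16 * (α * B / σ ^ 2) ^ 2 * (9 / 32 * ε ^ 2) := by gcongr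
      _ = _ := by ring
  · have : 0 < (α * B / σ ^ 2) ^ 2 * ε ^ 2 := by positivity
    nlinarith
  · generalize α * B / σ ^ 2 = a at ha
    congr 3
    field_simp
    ring

/-- The lower deviation bound, uniformly over the shell `s² ≤ ρ² < 4 s²` with `s = 2ⁱ ε`. -/
lemma measure_excessLoss_shell_le {Ω : Type*} [MeasurableSpace Ω] {μ : Measure Ω}
    [IsProbabilityMeasure μ] {n : ℕ} {X : Fin n → Ω → E D × E D} (hind : iIndepFun X μ)
    (hX : ∀ i, HasLaw (X i) (dataLaw α σ π hstar) μ)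
    (hπ : IsLatentDensity π 𝒰) (hα : 0 < α) (hσ : 0 < σ) (hB : 0 < B)
    (hms : Measurable hstar) (hbs : ∀ u ∈ 𝒰, ‖hstar u‖ ≤ B) {ℋ : Set (E d → E D)}
    (hℋm : ∀ h ∈ ℋ, Measurable h) (hℋb : ∀ h ∈ ℋ, ∀ u ∈ 𝒰, ‖h u‖ ≤ B)
    {ε k : ℝ} (hε : 0 < ε) (hk : 0 < k) (hk1 : k < 1)
    (hent : ∫⁻ u in Set.Ioc (k * ε ^ 2 / 16) (α * B / σ ^ 2 * ε),
        bracketingEntropy (dataLaw α σ π hstar) (excessLossClass α σ π hstar ℋ) u ^ (1 / 2 : ℝ) ≤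
      ENNReal.ofReal (√n * ε ^ 2 / 2048))
    {e₀ : ℝ} (he₀ : e₀ ≤ n * ε ^ 2 / (20480 * (α * B / σ ^ 2) ^ 2))
    (he₀' : Real.exp (-e₀) ≤ 1 / 4) (i : ℕ) :
    μ {ω | ∃ h ∈ ℋ, (2 ^ i * ε) ^ 2 ≤ rhoSq α σ π hstar h ∧
        rhoSq α σ π hstar h < (2 ^ (i + 1) * ε) ^ 2 ∧
        7 / 16 * (2 ^ i * ε) ^ 2 ≤ rhoSq α σ π hstar h -
          empMean (fun i => X i ω) (excessLoss α σ π hstar h)} ≤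
      ENNReal.ofReal (4 / 3 * Real.exp (-e₀) ^ (i + 1)) := by
  have := isProbabilityMeasure_dataLaw (α := α) (σ := σ) hπ hms
  set P := dataLaw α σ π hstar with hP
  set a := α * B / σ ^ 2 with ha_def
  have ha : 0 < a := by positivity
  have he₀0 : 0 < e₀ := by
    by_contra hcon
    have : 1 ≤ Real.exp (-e₀) := Real.one_le_exp (by linarith)
    linarith
  have h2i : (1 : ℝ) ≤ 2 ^ i := one_le_pow₀ (by norm_num)
  set F' : Set (E D × E D → ℝ) := excessLoss α σ π hstar '' {h | h ∈ ℋ ∧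
    (2 ^ i * ε) ^ 2 ≤ rhoSq α σ π hstar h ∧ rhoSq α σ π hstar h < (2 ^ (i + 1) * ε) ^ 2} with hF'
  have hsub : {ω | ∃ h ∈ ℋ, (2 ^ i * ε) ^ 2 ≤ rhoSq α σ π hstar h ∧
        rhoSq α σ π hstar h < (2 ^ (i + 1) * ε) ^ 2 ∧
        7 / 16 * (2 ^ i * ε) ^ 2 ≤ rhoSq α σ π hstar h -
          empMean (fun i => X i ω) (excessLoss α σ π hstar h)} ⊆
      {ω | ∃ f ∈ F', 7 / 16 * (2 ^ i * ε) ^ 2 ≤ ∫ x, f x ∂P -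
        empMean (fun i => X i ω) f} := by
    rintro ω ⟨h, hh, h1, h2, h3⟩
    refine ⟨_, ⟨h, ⟨hh, h1, h2⟩, rfl⟩, ?_⟩
    rwa [← rhoSq_eq_integral_excessLoss hπ hσ (hℋm h hh) (hℋb h hh) hms hbs]
  refine (measure_mono hsub).trans ?_
  rcases F'.eq_empty_or_nonempty with hempty | hne
  · simp [hempty]
  -- A nonempty shell contains a map with `ρ² ≥ s²`, while always `ρ² ≤ 4a²`.
  have hs : 2 ^ i * ε ≤ 2 * a := by
    obtain ⟨_, h, ⟨hh, h1, -⟩, rfl⟩ := hne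
    have h2 := rhoSq_le (α := α) hπ hσ (hℋm h hh) (hℋb h hh) hms hbs
    refine (abs_le_of_sq_le_sq' ?_ (by positivity)).2
    calc (2 ^ i * ε) ^ 2 ≤ _ := h1
      _ ≤ _ := h2
      _ = (2 * a) ^ 2 := by ring
  have hεa : ε ≤ 2 * a := (le_mul_of_one_le_left hε.le h2i).trans hs
  have hFF : F' ⊆ excessLossClass α σ π hstar ℋ := by
    rintro _ ⟨h, ⟨hh, -⟩, rfl⟩
    exact ⟨h, hh, rfl⟩
  -- `M` is the last dyadic index with `2^M L ≤ aε`, so the top scale lies between `aε/2` and `aε`.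
  obtain ⟨M, hM₁, hM₂⟩ := exists_nat_pow_near (x := a * ε / (k * ε ^ 2 / 16)) (y := 2)
    (by
      rw [one_le_div (by positivity)]
      have h1 : k * ε ^ 2 ≤ ε ^ 2 := mul_le_of_le_one_left (sq_nonneg _) hk1.le
      nlinarith) (by norm_num)
  rw [le_div_iff₀ (by positivity)] at hM₁
  rw [div_lt_iff₀ (by positivity), pow_succ] at hM₂
  obtain ⟨N, hN, hsum⟩ := exists_dyadic_covers (P := P) (hne.mono hFF)
    (L := k * ε ^ 2 / 16) (c := √n * ε ^ 2 / 2048) (by positivity) (by positivity) M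
    ((lintegral_mono_set (Set.Ioc_subset_Ioc_right hM₁)).trans hent)
  -- The admissible exponent grows like `4^i ≥ i + 1`; linear growth is enough to make the shell
  -- probabilities geometric in `i`.
  set e := ((i : ℝ) + 1) * e₀ with he
  have hexp : Real.exp (-e) = Real.exp (-e₀) ^ (i + 1) := by
    rw [← Real.exp_nat_mul, he]
    congr 1
    push_cast
    ring
  have hi4 : (i : ℝ) + 1 ≤ (2 ^ i) ^ 2 := by
    have h1 : (i : ℝ) + 1 ≤ 2 ^ i := by exact_mod_cast i.lt_two_pow_self
    exact h1.trans (le_self_pow₀ h2i (by norm_num))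
  have hFb : ∀ᵐ x ∂P, ∀ f ∈ F', -(4 * a ^ 2) ≤ f x := by
    filter_upwards [ae_dataLaw hπ hms hbs] with x hx
    rintro _ ⟨h, ⟨hh, -⟩, rfl⟩
    exact (abs_le.1 (abs_excessLoss_le hπ hσ (hℋm h hh) (hℋb h hh) hms hbs hx.1)).1
  have hFm : ∀ f ∈ F', MemLp f 2 P := by
    rintro _ ⟨h, ⟨hh, -⟩, rfl⟩
    exact memLp_excessLoss hπ hσ (hℋm h hh) (hℋb h hh) hms hbs
  have hFv : ∀ f ∈ F', ∫ x, f x ^ 2 ∂P ≤ (8 * a * (2 ^ i * ε)) ^ 2 := by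
    rintro _ ⟨h, ⟨hh, -, h2⟩, rfl⟩
    refine (integral_sq_excessLoss_le hπ hσ (hℋm h hh) (hℋb h hh) hms hbs).trans ?_
    calc 16 * a ^ 2 * rhoSq α σ π hstar h ≤ 16 * a ^ 2 * (2 ^ (i + 1) * ε) ^ 2 := by gcongr
      _ = _ := by rw [pow_succ]; ring
  have hei : e ≤ n * (2 ^ i * ε) ^ 2 / (20480 * a ^ 2) := by
    calc e ≤ (2 ^ i) ^ 2 * (n * ε ^ 2 / (20480 * a ^ 2)) := by
          rw [he]
          gcongr
      _ = _ := by ring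
  obtain ⟨J, hJ⟩ := measure_dyadic_shell_le hind hX ha hε hk hk1 (M := M)
    (by linarith) hM₁ hN hsum hFF hne hs hFb hFm hFv (by positivity) hei
  refine hJ.trans ((ofReal_exp_add_sum_le ?_ J).trans_eq (by rw [hexp]))
  rw [hexp]
  exact (pow_le_of_le_one (Real.exp_pos _).le (by linarith) (by omega)).trans he₀'

/-- An empirical minimizer of the anchor loss with large excess risk forces a deviation, either at
the comparison map `h₀` or on one of the shells. -/
lemma exists_deviation {K n : ℕ} {q : E D → E d → ℝ} {a : E D → Fin K → E d}
    {x : Fin n → E D × E D} {h h₀ : E d → E D} {ε : ℝ} (hε : 0 < ε)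
    (hmin : empiricalRisk α σ π q a x h ≤ empiricalRisk α σ π q a x h₀)
    (hx : ∀ i, |anchorLoss α σ π q a h (x i) - loss α σ π h (x i)| ≤ ε ^ 2 / 8)
    (hx₀ : ∀ i, |anchorLoss α σ π q a h₀ (x i) - loss α σ π h₀ (x i)| ≤ ε ^ 2 / 8)
    (hh₀ : rhoSq α σ π hstar h₀ ≤ 9 / 32 * ε ^ 2) (hh : ε ^ 2 ≤ rhoSq α σ π hstar h) :
    ε ^ 2 / 32 ≤ empMean x (excessLoss α σ π hstar h₀) - rhoSq α σ π hstar h₀ ∨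
      ∃ i : ℕ, (2 ^ i * ε) ^ 2 ≤ rhoSq α σ π hstar h ∧
        rhoSq α σ π hstar h < (2 ^ (i + 1) * ε) ^ 2 ∧
        7 / 16 * (2 ^ i * ε) ^ 2 ≤ rhoSq α σ π hstar h -
          empMean x (excessLoss α σ π hstar h) := by
  refine or_iff_not_imp_left.2 fun hcon => ?_
  rw [not_le] at hcon
  have hconst : empMean x (fun _ => ε ^ 2 / 8) ≤ ε ^ 2 / 8 := by
    rcases Nat.eq_zero_or_pos n with rfl | hn
    · simp only [empMean, Finset.univ_eq_empty, Finset.sum_empty, mul_zero]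
      positivity
    · have : (n : ℝ) ≠ 0 := by exact_mod_cast hn.ne'
      simp only [empMean, Finset.sum_const, Finset.card_univ, Fintype.card_fin, nsmul_eq_mul]
      field_simp
      exact le_rfl
  have h1 : empMean x (loss α σ π h) ≤ empMean x (anchorLoss α σ π q a h) + ε ^ 2 / 8 := by
    refine le_trans ?_ (add_le_add_right hconst _)
    rw [← empMean_add]
    exact empMean_mono fun i => by linarith [(abs_le.1 (hx i)).1]
  have h2 : empMean x (anchorLoss α σ π q a h₀) ≤ empMean x (loss α σ π h₀) + ε ^ 2 / 8 := by
    refine le_trans ?_ (add_le_add_right hconst _)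
    rw [← empMean_add]
    exact empMean_mono fun i => by linarith [(abs_le.1 (hx₀ i)).2]
  have h3 : empMean x (anchorLoss α σ π q a h) ≤ empMean x (anchorLoss α σ π q a h₀) := hmin
  have h4 : empMean x (excessLoss α σ π hstar h) =
      empMean x (loss α σ π h) - empMean x (loss α σ π hstar) := empMean_sub _ _ _
  have h5 : empMean x (excessLoss α σ π hstar h₀) =
      empMean x (loss α σ π h₀) - empMean x (loss α σ π hstar) := empMean_sub _ _ _
  -- `9/32` from the risk of `h₀`, `1/32` from its fluctuation, and `1/8` twice from replacing
  -- anchor losses by ideal ones.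
  have h6 : empMean x (excessLoss α σ π hstar h) ≤ 9 / 16 * ε ^ 2 := by linarith
  have hε2 : 0 < ε ^ 2 := by positivity
  obtain ⟨i, hi₁, hi₂⟩ := exists_nat_pow_near (x := rhoSq α σ π hstar h / ε ^ 2) (y := 4)
    ((one_le_div hε2).2 hh) (by norm_num)
  rw [le_div_iff₀ hε2] at hi₁
  rw [div_lt_iff₀ hε2] at hi₂
  have hpow : ∀ j : ℕ, ((2 : ℝ) ^ j * ε) ^ 2 = 4 ^ j * ε ^ 2 := fun j => by
    rw [mul_pow, ← pow_mul, mul_comm j 2, pow_mul]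
    norm_num
  refine ⟨i, ?_, ?_, ?_⟩
  · rwa [hpow]
  · rwa [hpow]
  -- `ρ² ≥ 4^i ε²` and `4^i ≥ 1` give `ρ² - (9/16) ε² ≥ (7/16) 4^i ε²`.
  · rw [hpow]
    linarith

end Minimizer

end ScoreMatching

end

/-! ### Assembly of the tail bound. -/

theorem theorem2
    {d D K n : ℕ}
    -- noise level, latent density and transport maps
    (α σ B : ℝ) (hα : 0 < α) (hσ : 0 < σ) (hB : 0 < B)
    (𝒰 : Set (E d)) (π : E d → ℝ) (hπ : IsLatentDensity π 𝒰)
    (hstar : E d → E D) (hstar_meas : Measurable hstar) (hstar_bdd : ∀ u ∈ 𝒰, ‖hstar u‖ ≤ B)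
    (ℋ : Set (E d → E D))
    (hℋ_meas : ∀ h ∈ ℋ, Measurable h) (hℋ_bdd : ∀ h ∈ ℋ, ∀ u ∈ 𝒰, ‖h u‖ ≤ B)
    -- the i.i.d. sample of pairs `(y_t, y_0)`
    {Ω : Type*} [MeasurableSpace Ω] (μ : Measure Ω) [IsProbabilityMeasure μ]
    (X : Fin n → Ω → E D × E D) (hX_indep : iIndepFun X μ)
    (hX_law : ∀ i, HasLaw (X i) (dataLaw α σ π hstar) μ)
    -- proposal density and anchors; the anchors are any points, deterministic or random, which may
    -- depend on the observation `y` and on the sample (as do i.i.d. draws from `q y`)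
    (q : E D → E d → ℝ) (a : Ω → E D → Fin K → E d)
    -- the empirical minimizer
    (hhat : Ω → E d → E D)
    (hhat_min : ∀ᵐ ω ∂μ, hhat ω ∈ ℋ ∧ ∀ h ∈ ℋ,
      empiricalRisk α σ π q (a ω) (fun i => X i ω) (hhat ω) ≤
        empiricalRisk α σ π q (a ω) (fun i => X i ω) h)
    (k : ℝ) (hk_pos : 0 < cb α σ B / (4 * cv α σ B)) (hk_ge : cb α σ B / (4 * cv α σ B) ≤ k)
    (hk_lt : k < 1)
    (ε : ℝ) (hε : 0 < ε)
    -- the bracketing-entropy condition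
    (hentropy :
      ∫⁻ u in Set.Ioc (k * ε ^ 2 / 16) (4 * (cv α σ B) ^ (1 / 2 : ℝ) * ε),
          (bracketingEntropy (dataLaw α σ π hstar) (excessLossClass α σ π hstar ℋ) u) ^ (1 / 2 : ℝ)
        ≤ ENNReal.ofReal (ch k * (n : ℝ) ^ (1 / 2 : ℝ) * ε ^ 2))
    -- `ε²` dominates the approximation error and the anchor perturbation over the sample space
    (happrox : 4 * (⨅ h : ℋ, rhoSq α σ π hstar h) ≤ ε ^ 2)
    (hanchor : ∀ᵐ ω ∂μ, ∀ h ∈ ℋ, ∀ y : E D, ∀ y₀ ∈ targetManifold 𝒰 π hstar,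
      8 * |anchorLoss α σ π q (a ω) h (y, y₀) - loss α σ π h (y, y₀)| ≤ ε ^ 2) :
    μ {ω | ε ≤ rho α σ π hstar (hhat ω)} ≤
      ENNReal.ofReal (4 * Real.exp (-(ce α σ B k * n * ε ^ 2))) := by
  have hk : 0 < k := hk_pos.trans_le hk_ge
  set A := α * B / σ ^ 2 with hA
  have hA0 : 0 < A := by positivity
  have hcv : cv α σ B = 40 * A ^ 2 := by rw [cv, hA]; ring
  have hcb : cb α σ B = 16 * A ^ 2 := by rw [cb, hA]; ring
  set e₀ := ce α σ B k * n * ε ^ 2 with he₀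
  -- If `exp (-e₀) > 1/4` the claimed bound exceeds `1`. Otherwise the geometric series below have
  -- ratio at most `1/4`.
  rcases lt_or_ge (1 / 4) (Real.exp (-e₀)) with hbig | hsmall
  · refine prob_le_one.trans ?_
    rw [← ENNReal.ofReal_one]
    exact ENNReal.ofReal_le_ofReal (by linarith)
  -- `8 · 64 · 40 = 20480`; the factor `1 - k` and the `c_b` term only decrease `c_e`.
  have hce : ce α σ B k ≤ 1 / (20480 * A ^ 2) := by
    rw [ce, hcv, hcb, div_le_div_iff₀ (by positivity) (by positivity)]
    nlinarith [sq_nonneg A]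
  have he₀' : e₀ ≤ n * ε ^ 2 / (20480 * A ^ 2) := by
    calc e₀ ≤ 1 / (20480 * A ^ 2) * n * ε ^ 2 := by rw [he₀]; gcongr
      _ = _ := by ring
  have hent : ∫⁻ u in Set.Ioc (k * ε ^ 2 / 16) (A * ε),
      bracketingEntropy (dataLaw α σ π hstar) (excessLossClass α σ π hstar ℋ) u ^ (1 / 2 : ℝ) ≤
      ENNReal.ofReal (√n * ε ^ 2 / 2048) := by
    refine (lintegral_mono_set (Set.Ioc_subset_Ioc_right ?_)).trans
      (hentropy.trans (ENNReal.ofReal_le_ofReal ?_))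
    · rw [hcv, ← Real.sqrt_eq_rpow]
      have h1 : A ≤ √(40 * A ^ 2) := Real.le_sqrt_of_sq_le (by nlinarith [sq_nonneg A])
      nlinarith
    · rw [ch, ← Real.sqrt_eq_rpow]
      have h1 : k ^ (3 / 2 : ℝ) ≤ 1 := Real.rpow_le_one hk.le hk_lt.le (by norm_num)
      have h2 : 0 ≤ √(n : ℝ) * ε ^ 2 := by positivity
      nlinarith
  obtain ⟨ω₀, hω₀⟩ := hhat_min.exists
  have : Nonempty ℋ := ⟨⟨_, hω₀.1⟩⟩
  -- The infimum is at most `ε²/4 = (8/32) ε²` but need not be attained; the slack `1/32` provides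
  -- an actual `h₀`.
  obtain ⟨⟨h₀, hh₀⟩, hlt⟩ := exists_lt_of_ciInf_lt
    (show (⨅ h : ℋ, rhoSq α σ π hstar h) < 9 / 32 * ε ^ 2 by nlinarith [pow_pos hε 2])
  simp only at hlt
  have hdev₀ := measure_empMean_excessLoss_ge_le hX_indep hX_law hπ hα hσ hB (hℋ_meas h₀ hh₀)
    (hℋ_bdd h₀ hh₀) hstar_meas hstar_bdd hε hlt.le
  have hshell := fun i => measure_excessLoss_shell_le hX_indep hX_law hπ hα hσ hB hstar_meas
    hstar_bdd hℋ_meas hℋ_bdd hε hk hk_lt hent he₀' hsmall i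
  rw [← rhoSq_eq_integral_excessLoss hπ hσ (hℋ_meas h₀ hh₀) (hℋ_bdd h₀ hh₀) hstar_meas
    hstar_bdd] at hdev₀
  have hincl := measure_mono_ae (μ := μ) (s := {ω | ε ≤ rho α σ π hstar (hhat ω)})
    (t := {ω | ε ^ 2 / 32 ≤ empMean (fun i => X i ω) (excessLoss α σ π hstar h₀) -
        rhoSq α σ π hstar h₀} ∪
      ⋃ i : ℕ, {ω | ∃ h ∈ ℋ, (2 ^ i * ε) ^ 2 ≤ rhoSq α σ π hstar h ∧
        rhoSq α σ π hstar h < (2 ^ (i + 1) * ε) ^ 2 ∧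
        7 / 16 * (2 ^ i * ε) ^ 2 ≤ rhoSq α σ π hstar h -
          empMean (fun i => X i ω) (excessLoss α σ π hstar h)}) (by
    filter_upwards [hhat_min, hanchor,
      ae_forall_sample hX_law (ae_dataLaw hπ hstar_meas hstar_bdd)] with ω hmin hanc hsample hρ
    have hclose : ∀ h ∈ ℋ, ∀ i, |anchorLoss α σ π q (a ω) h (X i ω) -
        loss α σ π h (X i ω)| ≤ ε ^ 2 / 8 := fun h hh i =>
      abs_anchorLoss_sub_loss_le_of_mem_closure hσ
        (fun y₀ hy₀ => by linarith [hanc h hh (X i ω).1 y₀ hy₀]) _ (hsample i).2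
    have hρ' : ε ^ 2 ≤ rhoSq α σ π hstar (hhat ω) := (Real.le_sqrt' hε).1 hρ
    rcases exists_deviation hε (hmin.2 h₀ hh₀) (hclose _ hmin.1) (hclose _ hh₀) hlt.le hρ'
      with hd | ⟨i, hi⟩
    · exact Or.inl hd
    · exact Or.inr (Set.mem_iUnion.2 ⟨i, hhat ω, hmin.1, hi⟩))
  refine hincl.trans ((measure_union_le _ _).trans ((add_le_add hdev₀
    ((measure_iUnion_le _).trans ((ENNReal.tsum_le_tsum hshell).trans
      (tsum_ofReal_mul_pow_le (Real.exp_pos _).le hsmall)))).trans ?_))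
  rw [← ENNReal.ofReal_add (Real.exp_pos _).le (by positivity)]
  refine ENNReal.ofReal_le_ofReal ?_
  have h1 : Real.exp (-(n * ε ^ 2 / (18432 * A ^ 2))) ≤ Real.exp (-e₀) := by
    rw [Real.exp_le_exp]
    refine neg_le_neg (he₀'.trans ?_)
    gcongr
    norm_num
  -- The deviation at `h₀` contributes `1` and the shells `16/9` times `exp (-e₀)`, below the
  -- allowed `4`.
  linarith [Real.exp_pos (-e₀)]
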